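/- Let $n\ge 0$, $\kappa=(\kappa_1,\dots,\kappa_n)$ with positive integers $\kappa_l$, and put $|x|_\kappa=\big(\sum_{l=1}^n|x^l|^{2/\kappa_l}\big)^{1/2}$ for $x\in\mathbb R^n$ and $\alpha\cdot\kappa=\sum_l\alpha_l\kappa_l$ for multi-indices $\alpha\in\mathbb N_0^n$. Let $\mathcal A,\mathcal B\subset\mathbb N_0^n$ be finite sets of multi-indices such that, for a fixed $m\in\mathbb N_0$, $(\alpha+\beta)\cdot\kappa=m$ for all $\alpha\in\mathcal A$, $\beta\in\mathcal B$, and let $\lambda>0$ and $\Lambda$ be real numbers. Write $D^\alpha=\partial_1^{\alpha_1}\cdots\partial_n^{\alpha_n}$. Then there is a constant $C\ge 0$, depending only on $n,\kappa,m,\mathcal A,\mathcal B,\lambda,\Lambda$, with the following property. Let $a_{\alpha\beta}\in\mathbb C$ ($\alpha\in\mathcal A$, $\beta\in\mathcal B$) be constants whose symbol $p(\xi)=\sum_{\alpha\in\mathcal A,\beta\in\mathcal B}a_{\alpha\beta}(i\xi)^{\alpha+\beta}$ satisfies the hypoellipticity condition $$\lambda|\xi|_\kappa^m\le|p(\xi)|\le\Lambda|\xi|_\kappa^m\qquad(\xi\in\mathbb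 R^n).$$ Let $u\in\mathcal S'(\mathbb R^n)$ solve $$Pu=\sum_{\alpha\in\mathcal A,\beta\in\mathcal B}a_{\alpha\beta}D^{\alpha+\beta}u=\sum_{\beta\in\mathcal B}D^\beta f_\beta$$ in the sense of distributions, where the $f_\beta$ are tempered distributions represented by complex-valued continuous functions of at most polynomial growth (again denoted $f_\beta$). Put $$\omega_f(\rho)=\sup_{|x-y|_\kappa\le\rho}\ \sum_{\beta\in\mathcal B}|f_\beta(x)-f_\beta(y)|\in[0,\infty],$$ and assume $\int_0^1\frac{\omega_f(\rho)}{\rho}\,d\rho<\infty$ and $\int_1^\infty\frac{\omega_f(\rho)}{\rho^2}\,d\rho<\infty$. Then for every $\alpha\in\mathbb N_0^n$ with $(\alpha+\beta)\cdot\kappa=m$ for all $\beta\in\mathcal B$ (in particular for every $\alpha\in\mathcal A$), the distribution $D^\alpha u$ is represented by a continuous function, and there is a polynomial $Q_\alpha$ with complex coefficients such that for all $x,y\in\mathbb R^n$ $$\big|[D^\alpha u(x)-Q_\alpha(x)]-[D^\alpha u(y)-Q_\alpha(y)]\big|\le C\left(\int_0^{|x-y|_\kappa}\frac{\omega_f(\rho)}{\rho}\,d\rho+|x-y|_\kappa\int_{|x-y|_\kappa}^\infty\frac{\omega_f(\rho)}{\rho^2}\,d\rho\right),$$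 where for $x=y$ the right-hand side is read as $0$. -/

import Mathlib

open MeasureTheory Set
open scoped NNReal ENNReal SchwartzMap LineDeriv

noncomputable section

namespace AnisotropicSchauder

/-- The weighted order `α · κ = ∑ l, α_l κ_l` of a multi-index. -/
def weightedOrder {n : ℕ} (κ α : Fin n → ℕ) : ℕ :=
  ∑ l, α l * κ l

/-- The quasi-norm `|x|_κ = (∑ l, |x_l|^(2/κ_l))^(1/2)`. -/
def quasiNorm {n : ℕ} (κ : Fin n → ℕ) (x : EuclideanSpace ℝ (Fin n)) : ℝ :=
  Real.sqrt (∑ l, |x l| ^ (2 / (κ l : ℝ)))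

/-- The partial derivative `D^α = ∂_1^{α_1} ⋯ ∂_n^{α_n}` of a tempered distribution. -/
def multiDeriv {n : ℕ} (α : Fin n → ℕ) (u : 𝓢'(EuclideanSpace ℝ (Fin n), ℂ)) :
    𝓢'(EuclideanSpace ℝ (Fin n), ℂ) :=
  (List.finRange n).foldr
    (fun l v => (fun w : 𝓢'(EuclideanSpace ℝ (Fin n), ℂ) =>
      ∂_{EuclideanSpace.single l (1 : ℝ)} w)^[α l] v) u

/-- The symbol `p(ξ) = ∑_{α ∈ 𝒜, β ∈ ℬ} a_{αβ} (iξ)^{α+β}`. -/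
def symbol {n : ℕ} (𝒜 ℬ : Finset (Fin n → ℕ)) (a : (Fin n → ℕ) → (Fin n → ℕ) → ℂ)
    (ξ : EuclideanSpace ℝ (Fin n)) : ℂ :=
  ∑ α ∈ 𝒜, ∑ β ∈ ℬ, a α β * ∏ l, (Complex.I * (ξ l : ℂ)) ^ (α l + β l)

/-- `P u = ∑_{α ∈ 𝒜, β ∈ ℬ} a_{αβ} D^{α+β} u`. -/
def constCoeffOp {n : ℕ} (𝒜 ℬ : Finset (Fin n → ℕ)) (a : (Fin n → ℕ) → (Fin n → ℕ) → ℂ)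
    (u : 𝓢'(EuclideanSpace ℝ (Fin n), ℂ)) : 𝓢'(EuclideanSpace ℝ (Fin n), ℂ) :=
  ∑ α ∈ 𝒜, ∑ β ∈ ℬ, a α β • multiDeriv (α + β) u

/-- The tempered distribution `T` is represented by the function `g`. -/
def IsRepresentedBy {n : ℕ} (T : 𝓢'(EuclideanSpace ℝ (Fin n), ℂ))
    (g : EuclideanSpace ℝ (Fin n) → ℂ) : Prop :=
  ∀ φ : 𝓢(EuclideanSpace ℝ (Fin n), ℂ),
    Integrable (fun x => φ x * g x) ∧ T φ = ∫ x, φ x * g x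

/-- `g` has at most polynomial growth. -/
def PolynomialGrowth {n : ℕ} (g : EuclideanSpace ℝ (Fin n) → ℂ) : Prop :=
  ∃ (K : ℝ) (N : ℕ), ∀ x, ‖g x‖ ≤ K * (1 + ‖x‖) ^ N

/-- `ω_f(ρ) = sup_{|x-y|_κ ≤ ρ} ∑_{β ∈ ℬ} |f_β(x) - f_β(y)|`, with values in `[0, ∞]`. -/
def oscillation {n : ℕ} (κ : Fin n → ℕ) (ℬ : Finset (Fin n → ℕ))
    (f : (Fin n → ℕ) → EuclideanSpace ℝ (Fin n) → ℂ) (ρ : ℝ) : ℝ≥0∞ :=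
  ⨆ (x : EuclideanSpace ℝ (Fin n)) (y : EuclideanSpace ℝ (Fin n))
    (_ : quasiNorm κ (x - y) ≤ ρ), ∑ β ∈ ℬ, ‖f β x - f β y‖ₑ

/-- `∫_0^r ω(ρ)/ρ dρ + r ∫_r^∞ ω(ρ)/ρ² dρ`. -/
def diniBound (ω : ℝ → ℝ≥0∞) (r : ℝ) : ℝ≥0∞ :=
  (∫⁻ ρ in Ioo 0 r, ω ρ / ENNReal.ofReal ρ) +
    ENNReal.ofReal r * ∫⁻ ρ in Ioi r, ω ρ / ENNReal.ofReal (ρ ^ 2)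

end AnisotropicSchauder

end

noncomputable section

namespace AnisotropicSchauder

/-! On the Fourier side `D^α u` is formally the sum over `β` of the multiplier `(iξ)^(α+β) / p(ξ)`
applied to `f_β`. This multiplier is smooth away from the origin and invariant under the anisotropic
dilations `δ_t`. Cut it into dyadic annuli: the piece at scale `2^j` is convolution with one fixed
Schwartz kernel rescaled by `δ_{2^j}`, and the kernel has mean zero because the annulus misses the
origin. Hence the increment of this piece between `x` and `y` is at most a constant times `min(1,
|x-y|_κ / 2^j) ω_f(2^j)` (`norm_piece_sub_piece_le`). Since `ω_f` is monotone, the sum of these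
bounds over `j` is dominated by the two Dini integrals (`diniBound_ge_dyadic`).

The pieces themselves need not be summable as `j → ∞`; only their increments are, so the sum is
taken of `h_j(x) - h_j(0)` (`IsDyadicFamily.sum`). It agrees with `D^α u` when tested against `𝓕 χ`
with `χ` flat to high order at the origin (`exists_order_tendsto_bandPass`). A functional that kills
all flat functions is a combination of derivatives at the origin, so the two differ by a polynomial
(`exists_polynomial_of_flat`). No distribution is ever divided by `p`: the equation is tested
against functions that already contain a cut-off reciprocal of `p` (`sum_apply_dilatedMultiplier`).

For the uniformity of `C`, the upper bound on the symbol confines its coefficients to a ball in a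
finite-dimensional space (`exists_norm_coeff_le`). The truncated multipliers depend smoothly on the
coefficients throughout that ball, so compactness bounds all kernels at once (`exists_kernels`). -/

/-- The anisotropic dilation `(x_l) ↦ (t^{κ_l} x_l)`. -/
def dilation {n : ℕ} (κ : Fin n → ℕ) (t : ℝ) :
    EuclideanSpace ℝ (Fin n) →L[ℝ] EuclideanSpace ℝ (Fin n) :=
  LinearMap.toContinuousLinearMap
    { toFun := fun x => WithLp.toLp 2 (fun l => t ^ κ l * x l)
      map_add' := fun x y => by ext l; simp [mul_add]
      map_smul' := fun c x => by ext l; simp; ring }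

/-! ### Anisotropic dilations and the quasi-norm. -/

section dilation

variable {n : ℕ} {κ : Fin n → ℕ}

@[simp] lemma dilation_apply (t : ℝ) (x : EuclideanSpace ℝ (Fin n)) (l : Fin n) :
    dilation κ t x l = t ^ κ l * x l := rfl

lemma dilation_dilation (s t : ℝ) (x : EuclideanSpace ℝ (Fin n)) :
    dilation κ s (dilation κ t x) = dilation κ (s * t) x := by
  ext l; simp [mul_pow]; ring

lemma dilation_one (x : EuclideanSpace ℝ (Fin n)) : dilation κ 1 x = x := by
  ext l; simp

lemma inner_dilation_left (t : ℝ) (x y : EuclideanSpace ℝ (Fin n)) :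
    inner ℝ (dilation κ t x) y = inner ℝ x (dilation κ t y) := by
  simp only [PiLp.inner_apply, dilation_apply]
  refine Finset.sum_congr rfl fun l _ => ?_
  simp; ring

lemma le_norm_dilation (hκ : ∀ l, 0 < κ l) {R : ℝ} (hR : 1 ≤ R)
    (x : EuclideanSpace ℝ (Fin n)) : R * ‖x‖ ≤ ‖dilation κ R x‖ := by
  have : R * ‖x‖ = ‖R • x‖ := by rw [norm_smul, Real.norm_of_nonneg (by linarith)]
  rw [this, EuclideanSpace.norm_eq, EuclideanSpace.norm_eq]
  refine Real.sqrt_le_sqrt (Finset.sum_le_sum fun l _ => ?_)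
  simp only [PiLp.smul_apply, smul_eq_mul, dilation_apply, norm_mul, norm_pow]
  rw [Real.norm_of_nonneg (by linarith : 0 ≤ R)]
  gcongr
  exact le_self_pow₀ hR (hκ l).ne'

lemma norm_dilation_apply_le (hκ : ∀ l, 0 < κ l) {r : ℝ} (h0 : 0 ≤ r) (hr : r ≤ 1)
    (x : EuclideanSpace ℝ (Fin n)) : ‖dilation κ r x‖ ≤ r * ‖x‖ := by
  have : r * ‖x‖ = ‖r • x‖ := by rw [norm_smul, Real.norm_of_nonneg h0]
  rw [this, EuclideanSpace.norm_eq, EuclideanSpace.norm_eq]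
  refine Real.sqrt_le_sqrt (Finset.sum_le_sum fun l _ => ?_)
  simp only [PiLp.smul_apply, smul_eq_mul, dilation_apply, norm_mul, norm_pow]
  rw [Real.norm_of_nonneg h0]
  gcongr
  exact pow_le_of_le_one h0 hr (hκ l).ne'

lemma norm_dilation_le {R : ℝ} (hR : 1 ≤ R) : ‖dilation κ R‖ ≤ R ^ (∑ l, κ l) := by
  refine ContinuousLinearMap.opNorm_le_bound _ (by positivity) fun x => ?_
  have : R ^ (∑ l, κ l) * ‖x‖ = ‖(R ^ (∑ l, κ l)) • x‖ := by
    rw [norm_smul, Real.norm_of_nonneg (by positivity)]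
  rw [this, EuclideanSpace.norm_eq, EuclideanSpace.norm_eq]
  refine Real.sqrt_le_sqrt (Finset.sum_le_sum fun l _ => ?_)
  simp only [PiLp.smul_apply, smul_eq_mul, dilation_apply, norm_mul, norm_pow]
  rw [Real.norm_of_nonneg (by linarith : 0 ≤ R)]
  gcongr
  exact Finset.single_le_sum (f := κ) (fun _ _ => Nat.zero_le _) (Finset.mem_univ l)

lemma norm_dilation_le_one (hκ : ∀ l, 0 < κ l) {r : ℝ} (h0 : 0 ≤ r) (hr : r ≤ 1) :
    ‖dilation κ r‖ ≤ 1 :=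
  ContinuousLinearMap.opNorm_le_bound _ zero_le_one fun x =>
    (norm_dilation_apply_le hκ h0 hr x).trans (by gcongr)

lemma quasiNorm_nonneg (x : EuclideanSpace ℝ (Fin n)) : 0 ≤ quasiNorm κ x := Real.sqrt_nonneg _

lemma quasiNorm_sq (x : EuclideanSpace ℝ (Fin n)) :
    quasiNorm κ x ^ 2 = ∑ l, |x l| ^ (2 / (κ l : ℝ)) :=
  Real.sq_sqrt (Finset.sum_nonneg fun _ _ => by positivity)

lemma quasiNorm_zero (hκ : ∀ l, 0 < κ l) : quasiNorm κ 0 = 0 := by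
  have : ∀ l, (0 : ℝ) ^ (2 / (κ l : ℝ)) = 0 := fun l =>
    Real.zero_rpow (by have := hκ l; positivity)
  simp [quasiNorm, this]

lemma quasiNorm_dilation (hκ : ∀ l, 0 < κ l) {t : ℝ} (ht : 0 ≤ t)
    (x : EuclideanSpace ℝ (Fin n)) : quasiNorm κ (dilation κ t x) = t * quasiNorm κ x := by
  rw [quasiNorm, quasiNorm, ← Real.sqrt_sq ht, ← Real.sqrt_mul (sq_nonneg _), Real.sqrt_sq ht,
    Finset.mul_sum]
  congr 1
  refine Finset.sum_congr rfl fun l _ => ?_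
  have h : (κ l : ℝ) ≠ 0 := by exact_mod_cast (hκ l).ne'
  rw [dilation_apply, abs_mul, abs_pow, abs_of_nonneg ht,
    Real.mul_rpow (by positivity) (abs_nonneg _), ← Real.rpow_natCast, ← Real.rpow_mul ht,
    mul_div_cancel₀ _ h]
  norm_num

lemma abs_le_quasiNorm_pow (hκ : ∀ l, 0 < κ l) (x : EuclideanSpace ℝ (Fin n)) (l : Fin n) :
    |x l| ≤ quasiNorm κ x ^ κ l := by
  have h : (κ l : ℝ) ≠ 0 := by exact_mod_cast (hκ l).ne'
  have h1 : |x l| ^ (2 / (κ l : ℝ)) ≤ quasiNorm κ x ^ 2 := by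
    rw [quasiNorm_sq]
    exact Finset.single_le_sum (f := fun l => |x l| ^ (2 / (κ l : ℝ)))
      (fun _ _ => by positivity) (Finset.mem_univ l)
  have h2 := Real.rpow_le_rpow (by positivity) h1 (by positivity : 0 ≤ (κ l : ℝ) / 2)
  rw [← Real.rpow_mul (abs_nonneg _), ← Real.rpow_natCast, ← Real.rpow_mul (quasiNorm_nonneg _)]
    at h2
  rw [show 2 / (κ l : ℝ) * ((κ l : ℝ) / 2) = 1 by field_simp, Real.rpow_one] at h2
  rwa [show ((2 : ℕ) : ℝ) * ((κ l : ℝ) / 2) = κ l by push_cast; ring, Real.rpow_natCast] at h2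

lemma eq_zero_of_quasiNorm_eq_zero (hκ : ∀ l, 0 < κ l) {x : EuclideanSpace ℝ (Fin n)}
    (h : quasiNorm κ x = 0) : x = 0 := by
  ext l
  have := abs_le_quasiNorm_pow hκ x l
  rw [h, zero_pow (hκ l).ne'] at this
  simpa using this

lemma continuous_quasiNorm : Continuous (quasiNorm κ) := by
  unfold quasiNorm
  refine Real.continuous_sqrt.comp (continuous_finsetSum _ fun l _ => ?_)
  exact Continuous.rpow_const (by fun_prop) fun x => Or.inr (by positivity)

lemma norm_le_of_quasiNorm_le_one (hκ : ∀ l, 0 < κ l) {x : EuclideanSpace ℝ (Fin n)}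
    (h : quasiNorm κ x ≤ 1) : ‖x‖ ≤ n * quasiNorm κ x := by
  have h1 : ‖x‖ ≤ ∑ l, ‖x l‖ := by
    have : x = ∑ l, EuclideanSpace.single l (x l) := by
      ext l; simp [Finset.sum_apply, Pi.single_apply]
    calc ‖x‖ = ‖∑ l, EuclideanSpace.single l (x l)‖ := by rw [← this]
      _ ≤ _ := (norm_sum_le _ _).trans (by simp)
  refine h1.trans ?_
  calc ∑ l, ‖x l‖ ≤ ∑ _l : Fin n, quasiNorm κ x := Finset.sum_le_sum fun l _ =>
        (abs_le_quasiNorm_pow hκ x l).trans (pow_le_of_le_one (quasiNorm_nonneg _) h (hκ l).ne')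
    _ = _ := by simp

/-- The radius makes each of the `n` summands at most `(n+1)^(-2)`, so their sum stays below one. -/
lemma quasiNorm_le_one_of_norm_le {x : EuclideanSpace ℝ (Fin n)} (hκ : ∀ l, 0 < κ l)
    (h : ‖x‖ ≤ (1 / (n + 1 : ℝ)) ^ (∑ l, κ l)) : quasiNorm κ x ≤ 1 := by
  rw [quasiNorm]
  refine Real.sqrt_le_iff.2 ⟨zero_le_one, ?_⟩
  rw [one_pow]
  have h1 : ∀ l, |x l| ^ (2 / (κ l : ℝ)) ≤ (1 / (n + 1 : ℝ)) ^ 2 := fun l => by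
    have hl : (κ l : ℝ) ≠ 0 := by exact_mod_cast (hκ l).ne'
    have h0 : (0 : ℝ) ≤ 1 / (n + 1 : ℝ) := by positivity
    have h2 : |x l| ≤ (1 / (n + 1 : ℝ)) ^ κ l := by
      refine ((PiLp.norm_apply_le x l).trans h).trans ?_
      refine pow_le_pow_of_le_one h0 ?_
        (Finset.single_le_sum (f := κ) (fun _ _ => Nat.zero_le _) (Finset.mem_univ l))
      rw [div_le_one (by positivity)]; linarith [(Nat.cast_nonneg n : (0:ℝ) ≤ n)]
    refine (Real.rpow_le_rpow (abs_nonneg _) h2 (by positivity)).trans_eq ?_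
    rw [← Real.rpow_natCast, ← Real.rpow_mul h0, mul_div_cancel₀ _ hl]
    norm_num
  refine (Finset.sum_le_sum fun l _ => h1 l).trans ?_
  simp only [Finset.sum_const, Finset.card_univ, Fintype.card_fin, nsmul_eq_mul]
  rw [div_pow, one_pow, mul_one_div, div_le_one (by positivity)]
  nlinarith [(Nat.cast_nonneg n : (0:ℝ) ≤ n)]

lemma quasiNorm_le_one_add_norm (hκ : ∀ l, 0 < κ l) (x : EuclideanSpace ℝ (Fin n)) :
    quasiNorm κ x ≤ (n + 1) * (1 + ‖x‖) := by
  rw [quasiNorm]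
  refine Real.sqrt_le_iff.2 ⟨by positivity, ?_⟩
  have h1 : ∀ l, |x l| ^ (2 / (κ l : ℝ)) ≤ (1 + ‖x‖) ^ 2 := fun l => by
    have hl : (1 : ℝ) ≤ κ l := by exact_mod_cast hκ l
    have h2 : |x l| ≤ 1 + ‖x‖ := (PiLp.norm_apply_le x l).trans (by linarith)
    refine (Real.rpow_le_rpow (abs_nonneg _) h2 (by positivity)).trans ?_
    rw [← Real.rpow_natCast]
    refine Real.rpow_le_rpow_of_exponent_le (by linarith [norm_nonneg x]) ?_
    push_cast
    exact div_le_self (by norm_num) hl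
  refine (Finset.sum_le_sum fun l _ => h1 l).trans ?_
  simp only [Finset.sum_const, Finset.card_univ, Fintype.card_fin, nsmul_eq_mul]
  rw [mul_pow]
  gcongr
  nlinarith [(Nat.cast_nonneg n : (0:ℝ) ≤ n)]

end dilation

/-! ### Growth of the oscillation and dyadic form of the Dini integrals. -/

section oscillation

variable {n : ℕ} {κ : Fin n → ℕ} {ℬ : Finset (Fin n → ℕ)}
  {f : (Fin n → ℕ) → EuclideanSpace ℝ (Fin n) → ℂ}

lemma sum_enorm_sub_le_oscillation {ρ : ℝ} {x y : EuclideanSpace ℝ (Fin n)}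
    (h : quasiNorm κ (x - y) ≤ ρ) :
    ∑ β ∈ ℬ, ‖f β x - f β y‖ₑ ≤ oscillation κ ℬ f ρ :=
  le_iSup₂_of_le x y (le_iSup_of_le h le_rfl)

lemma oscillation_mono : Monotone (oscillation κ ℬ f) := fun _ _ h =>
  iSup₂_mono fun _ _ => iSup_mono' fun h' => ⟨h'.trans h, le_rfl⟩

lemma sum_enorm_sub_le_nsmul {ρ : ℝ} {v : EuclideanSpace ℝ (Fin n)} (h : quasiNorm κ v ≤ ρ)
    (x : EuclideanSpace ℝ (Fin n)) (k : ℕ) :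
    ∑ β ∈ ℬ, ‖f β (x + (k : ℝ) • v) - f β x‖ₑ ≤ k * oscillation κ ℬ f ρ := by
  induction k with
  | zero => simp
  | succ k ih =>
    have h1 : ∑ β ∈ ℬ, ‖f β (x + ((k + 1 : ℕ) : ℝ) • v) - f β (x + (k : ℝ) • v)‖ₑ
        ≤ oscillation κ ℬ f ρ := sum_enorm_sub_le_oscillation (by
      convert h using 2
      push_cast
      module)
    calc _ ≤ ∑ β ∈ ℬ, (‖f β (x + ((k + 1 : ℕ) : ℝ) • v) - f β (x + (k : ℝ) • v)‖ₑ
          + ‖f β (x + (k : ℝ) • v) - f β x‖ₑ) := Finset.sum_le_sum fun β _ => by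
            rw [← sub_add_sub_cancel]; exact enorm_add_le _ _
      _ ≤ _ := by
        rw [Finset.sum_add_distrib, add_comm]
        rw [Nat.cast_succ (R := ℝ≥0∞), add_mul, one_mul]
        gcongr

/-- The growth constant of the oscillation along dilated increments. -/
def growthConst (κ : Fin n → ℕ) : ℝ := (n + 1 : ℝ) ^ (∑ l, κ l) + 2

lemma growthConst_nonneg : 0 ≤ growthConst κ := by unfold growthConst; positivity

/-- The segment from `x` to `x - δ_t y` is walked in `N` equal steps. Each step is `δ_t` of a vector
so short that its quasi-norm is at most one, so it costs one `ω(t)`. As `N` is linear in `‖y‖`, a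
kernel with one spare power of decay absorbs the loss. -/
lemma sum_enorm_sub_dilation_le (hκ : ∀ l, 0 < κ l) {t : ℝ} (ht : 0 < t)
    (x y : EuclideanSpace ℝ (Fin n)) :
    ∑ β ∈ ℬ, ‖f β (x - dilation κ t y) - f β x‖ₑ
      ≤ ENNReal.ofReal (growthConst κ * (1 + ‖y‖)) * oscillation κ ℬ f t := by
  set A : ℝ := (n + 1 : ℝ) ^ (∑ l, κ l) with hA
  have hA0 : 1 ≤ A := one_le_pow₀ (by linarith [(Nat.cast_nonneg n : (0:ℝ) ≤ n)])
  -- The extra step keeps `N` nonzero when `y = 0`.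
  set N : ℕ := ⌈A * ‖y‖⌉₊ + 1 with hN
  have hN0 : (0 : ℝ) < N := by positivity
  have hN1 : A * ‖y‖ ≤ N := by
    rw [hN]; push_cast; linarith [Nat.le_ceil (A * ‖y‖)]
  have hN2 : (N : ℝ) ≤ growthConst κ * (1 + ‖y‖) := by
    have := Nat.ceil_lt_add_one (show 0 ≤ A * ‖y‖ by positivity)
    rw [hN, growthConst, ← hA]; push_cast
    nlinarith [norm_nonneg y]
  have hv : quasiNorm κ (dilation κ t ((-1 / (N : ℝ)) • y)) ≤ t := by
    rw [quasiNorm_dilation hκ ht.le]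
    refine mul_le_of_le_one_right ht.le (quasiNorm_le_one_of_norm_le hκ ?_)
    rw [norm_smul, norm_div, norm_neg, norm_one, Real.norm_of_nonneg hN0.le, div_pow, one_pow,
      ← hA, one_div_mul_eq_div, div_le_div_iff₀ hN0 (by linarith)]
    linarith
  have := sum_enorm_sub_le_nsmul (ℬ := ℬ) (f := f) hv x N
  rw [← map_smul, smul_smul, mul_div_cancel₀ _ hN0.ne', neg_one_smul, map_neg, ← sub_eq_add_neg]
    at this
  refine this.trans ?_
  gcongr
  rw [← ENNReal.ofReal_natCast]
  exact ENNReal.ofReal_le_ofReal hN2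

/-- The integrand of the Dini bound has weight `min(1/ρ, r/ρ²)`. On `[2^j, 2^(j+1))` this is at
least `min(1, r/2^j) / (4 · 2^j)` and `ω(ρ) ≥ ω(2^j)`; the interval has length `2^j`, which leaves
the factor 4. -/
lemma diniBound_ge_dyadic {ω : ℝ → ℝ≥0∞} (hω : Monotone ω) {r : ℝ} (hr : 0 < r) :
    ∑' j : ℤ, ENNReal.ofReal (min 1 (r / 2 ^ j)) * ω (2 ^ j) ≤ 4 * diniBound ω r := by
  set Φ : ℝ → ℝ≥0∞ := fun ρ => ENNReal.ofReal (min (1 / ρ) (r / ρ ^ 2)) * ω ρ with hΦ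
  set S : ℤ → Set ℝ := fun j => Ico ((2 : ℝ) ^ j) (2 ^ (j + 1)) with hS
  have hdisj : Pairwise (Function.onFun Disjoint S) := by
    have := (zpow_right_strictMono₀ (one_lt_two : (1 : ℝ) < 2)).monotone.pairwise_disjoint_on_Ico_succ
    simpa [hS, Order.succ_eq_add_one] using this
  have hterm : ∀ j : ℤ, ENNReal.ofReal (min 1 (r / 2 ^ j)) * ω (2 ^ j)
      ≤ 4 * ∫⁻ ρ in S j, Φ ρ := fun j => by
    have h2 : (0 : ℝ) < 2 ^ j := by positivity
    have hlow : ∀ ρ ∈ S j, ENNReal.ofReal (min 1 (r / 2 ^ j) / (4 * 2 ^ j)) * ω (2 ^ j) ≤ Φ ρ := by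
      intro ρ hρ
      have hρ1 : (2 : ℝ) ^ j ≤ ρ := hρ.1
      have hρ2 : ρ ≤ 2 * 2 ^ j := by
        have := hρ.2.le
        rwa [zpow_add_one₀ two_ne_zero, mul_comm] at this
      have hρ0 : 0 < ρ := h2.trans_le hρ1
      refine mul_le_mul' (ENNReal.ofReal_le_ofReal (le_min ?_ ?_)) (hω hρ1)
      · rw [div_le_div_iff₀ (by positivity) hρ0]
        have : min 1 (r / 2 ^ j) ≤ 1 := min_le_left _ _
        nlinarith
      · have : min 1 (r / 2 ^ j) ≤ r / 2 ^ j := min_le_right _ _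
        calc min 1 (r / 2 ^ j) / (4 * 2 ^ j) ≤ r / 2 ^ j / (4 * 2 ^ j) := by gcongr
          _ = r / (2 * 2 ^ j) ^ 2 := by field_simp; norm_num
          _ ≤ _ := by gcongr
    have hvol : volume (S j) = ENNReal.ofReal (2 ^ j) := by
      rw [hS, Real.volume_Ico, zpow_add_one₀ two_ne_zero]; congr 1; ring
    have : ENNReal.ofReal (min 1 (r / 2 ^ j) / (4 * 2 ^ j)) * ω (2 ^ j) * ENNReal.ofReal (2 ^ j)
        ≤ ∫⁻ ρ in S j, Φ ρ := by
      rw [← hvol, ← setLIntegral_const]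
      exact setLIntegral_mono' measurableSet_Ico hlow
    calc _ = 4 * (ENNReal.ofReal (min 1 (r / 2 ^ j) / (4 * 2 ^ j)) * ω (2 ^ j)
              * ENNReal.ofReal (2 ^ j)) := by
            rw [mul_right_comm, ← mul_assoc, ← ENNReal.ofReal_mul (by positivity),
              show (4 : ℝ≥0∞) = ENNReal.ofReal 4 by norm_num, ← ENNReal.ofReal_mul (by norm_num)]
            congr 2
            field_simp
      _ ≤ _ := by gcongr
  -- The point `r` belongs to neither integral of `diniBound` but has measure zero.
  have hsub : (⋃ j, S j) ⊆ Ioo 0 r ∪ (Ioi r ∪ {r}) := by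
    intro ρ hρ
    obtain ⟨j, hj⟩ := mem_iUnion.1 hρ
    have : 0 < ρ := (show (0:ℝ) < 2 ^ j by positivity).trans_le hj.1
    rcases lt_trichotomy ρ r with h | h | h
    · exact Or.inl ⟨this, h⟩
    · exact Or.inr (Or.inr h)
    · exact Or.inr (Or.inl h)
  calc _ ≤ ∑' j : ℤ, 4 * ∫⁻ ρ in S j, Φ ρ := ENNReal.tsum_le_tsum hterm
    _ = 4 * ∫⁻ ρ in ⋃ j, S j, Φ ρ := by
      rw [ENNReal.tsum_mul_left, lintegral_iUnion (fun j => measurableSet_Ico) hdisj]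
    _ ≤ 4 * ((∫⁻ ρ in Ioo 0 r, Φ ρ) + ((∫⁻ ρ in Ioi r, Φ ρ) + ∫⁻ ρ in {r}, Φ ρ)) := by
      gcongr
      refine (lintegral_mono_set hsub).trans ((lintegral_union_le _ _ _).trans ?_)
      gcongr
      exact lintegral_union_le _ _ _
    _ ≤ 4 * diniBound ω r := by
      gcongr
      rw [Measure.restrict_singleton, Real.volume_singleton, zero_smul, lintegral_zero_measure,
        add_zero, diniBound]
      gcongr ?_ + ?_
      · refine setLIntegral_mono' measurableSet_Ioo fun ρ hρ => ?_
        simp only [hΦ]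
        rw [ENNReal.div_eq_inv_mul, ← ENNReal.ofReal_inv_of_pos hρ.1]
        gcongr
        exact (min_le_left _ _).trans_eq (one_div _)
      · rw [← lintegral_const_mul' _ _ ENNReal.ofReal_ne_top]
        refine setLIntegral_mono' measurableSet_Ioi fun ρ hρ => ?_
        have h0 : 0 < ρ := hr.trans hρ
        simp only [hΦ]
        rw [ENNReal.div_eq_inv_mul, ← ENNReal.ofReal_inv_of_pos (by positivity), ← mul_assoc,
          ← ENNReal.ofReal_mul hr.le]
        gcongr
        exact (min_le_right _ _).trans_eq (div_eq_mul_inv _ _)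

end oscillation

open Filter Topology
open scoped ContDiff FourierTransform

lemma norm_iteratedFDeriv_comp_clm_le {E F G : Type*} [NormedAddCommGroup E] [NormedSpace ℝ E]
    [NormedAddCommGroup F] [NormedSpace ℝ F] [NormedAddCommGroup G] [NormedSpace ℝ G]
    {f : F → G} (hf : ContDiff ℝ ∞ f) (g : E →L[ℝ] F) (i : ℕ) (x : E) :
    ‖iteratedFDeriv ℝ i (fun y => f (g y)) x‖ ≤ ‖iteratedFDeriv ℝ i f (g x)‖ * ‖g‖ ^ i := by
  have := g.iteratedFDeriv_comp_right hf x (i := i) (mod_cast le_top)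
  rw [show (fun y => f (g y)) = f ∘ g from rfl, this]
  refine (ContinuousMultilinearMap.norm_compContinuousLinearMap_le _ _).trans_eq ?_
  simp

/-! ### Schwartz seminorms of products, and functions flat at the origin. -/

section flat

variable {E : Type*} [NormedAddCommGroup E] [NormedSpace ℝ E]

/-- Taylor's estimate by descending induction on the order: the mean value inequality on the ball of
radius `‖x‖` gains one power of `‖x‖` for each vanishing derivative. -/
lemma norm_iteratedFDeriv_le_of_flat (χ : 𝓢(E, ℂ)) {L : ℕ}
    (h : ∀ i < L, iteratedFDeriv ℝ i χ 0 = 0) {i : ℕ} (hi : i ≤ L) (x : E) :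
    ‖iteratedFDeriv ℝ i χ x‖ ≤ SchwartzMap.seminorm ℂ 0 L χ * ‖x‖ ^ (L - i) := by
  induction hi using Nat.decreasingInduction generalizing x with
  | self => simpa using SchwartzMap.norm_iteratedFDeriv_le_seminorm ℂ χ L x
  | of_succ i hi ih =>
    have hd : ∀ y ∈ Metric.closedBall (0 : E) ‖x‖,
        DifferentiableAt ℝ (iteratedFDeriv ℝ i χ) y := fun y _ =>
      ((χ.smooth ⊤).differentiable_iteratedFDeriv (mod_cast ENat.natCast_lt_top i)) y
    have hb : ∀ y ∈ Metric.closedBall (0 : E) ‖x‖, ‖fderiv ℝ (iteratedFDeriv ℝ i χ) y‖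
        ≤ SchwartzMap.seminorm ℂ 0 L χ * ‖x‖ ^ (L - (i + 1)) := fun y hy => by
      rw [norm_fderiv_iteratedFDeriv]
      refine (ih y).trans ?_
      gcongr
      simpa using hy
    have := (convex_closedBall (0 : E) ‖x‖).norm_image_sub_le_of_norm_fderiv_le hd hb
      (Metric.mem_closedBall_self (norm_nonneg x)) (by simp : x ∈ Metric.closedBall (0 : E) ‖x‖)
    rw [h i hi, sub_zero, sub_zero, mul_assoc, ← pow_succ] at this
    rwa [show L - i = L - (i + 1) + 1 by omega]

/-- Leibniz rule, with `S` recording where the multiplier lives: the decay of `χ` is needed only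
there. -/
lemma seminorm_smulLeftCLM_le {h : E → ℂ} (hh : h.HasTemperateGrowth) (χ : 𝓢(E, ℂ)) {k l : ℕ}
    {A δ : ℝ} (hA0 : 0 ≤ A) (hδ0 : 0 ≤ δ) (S : Set E)
    (hA : ∀ i ≤ l, ∀ x, ‖iteratedFDeriv ℝ i h x‖ ≤ A)
    (hS : ∀ i, ∀ x ∉ S, iteratedFDeriv ℝ i h x = 0)
    (hδ : ∀ i ≤ l, ∀ x ∈ S, ‖x‖ ^ k * ‖iteratedFDeriv ℝ i χ x‖ ≤ δ) :
    SchwartzMap.seminorm ℂ k l (SchwartzMap.smulLeftCLM ℂ h χ) ≤ 2 ^ l * (A * δ) := by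
  refine SchwartzMap.seminorm_le_bound ℂ k l _ (by positivity) fun x => ?_
  rw [SchwartzMap.smulLeftCLM_apply hh]
  have h1 := norm_iteratedFDeriv_mul_le hh.1 (χ.smooth ⊤) x (n := l) (mod_cast le_top)
  calc _ ≤ ‖x‖ ^ k * ∑ i ∈ Finset.range (l + 1), (l.choose i : ℝ) *
          ‖iteratedFDeriv ℝ i h x‖ * ‖iteratedFDeriv ℝ (l - i) χ x‖ := by
        gcongr; exact h1
    _ = ∑ i ∈ Finset.range (l + 1), (l.choose i : ℝ) *
          (‖iteratedFDeriv ℝ i h x‖ * (‖x‖ ^ k * ‖iteratedFDeriv ℝ (l - i) χ x‖)) := by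
        rw [Finset.mul_sum]; exact Finset.sum_congr rfl fun i _ => by ring
    _ ≤ ∑ i ∈ Finset.range (l + 1), (l.choose i : ℝ) * (A * δ) := by
        refine Finset.sum_le_sum fun i hi => ?_
        refine mul_le_mul_of_nonneg_left ?_ (Nat.cast_nonneg _)
        by_cases hx : x ∈ S
        · refine mul_le_mul ?_ ?_ (by positivity) hA0
          · exact hA i (by simpa [Nat.lt_succ_iff] using hi) x
          · exact hδ _ (Nat.sub_le _ _) x hx
        · rw [hS i x hx]; simp; positivity
    _ = 2 ^ l * (A * δ) := by
        rw [← Finset.sum_mul, ← Nat.cast_sum, Nat.sum_range_choose]; norm_num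

end flat

/-- A smooth cutoff function, equal to one on the unit ball and supported in the ball of
radius two. -/
def cutoff (n : ℕ) (x : EuclideanSpace ℝ (Fin n)) : ℂ :=
  ((⟨1, 2, one_pos, one_lt_two⟩ : ContDiffBump (0 : EuclideanSpace ℝ (Fin n))) x : ℝ)

/-! ### Smooth cutoffs and band-pass truncation. -/

section cutoff

variable {n : ℕ} {κ : Fin n → ℕ}

lemma cutoff_of_norm_le {x : EuclideanSpace ℝ (Fin n)} (h : ‖x‖ ≤ 1) : cutoff n x = 1 := by
  rw [cutoff, ContDiffBump.one_of_mem_closedBall _ (by simpa using h)]; simp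

lemma cutoff_of_le_norm {x : EuclideanSpace ℝ (Fin n)} (h : 2 ≤ ‖x‖) : cutoff n x = 0 := by
  rw [cutoff, ContDiffBump.zero_of_le_dist _ (by simpa using h)]; simp

lemma contDiff_cutoff : ContDiff ℝ ∞ (cutoff n) :=
  Complex.ofRealCLM.contDiff.comp (ContDiffBump.contDiff _)

lemma hasCompactSupport_cutoff : HasCompactSupport (cutoff n) :=
  HasCompactSupport.of_support_subset_isCompact (isCompact_closedBall 0 2) fun x hx => by
    by_contra h
    exact hx (cutoff_of_le_norm (le_of_lt (by simpa using h)))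

lemma hasTemperateGrowth_cutoff : (cutoff n).HasTemperateGrowth :=
  hasCompactSupport_cutoff.hasTemperateGrowth contDiff_cutoff

lemma hasTemperateGrowth_cutoff_dilation (t : ℝ) :
    (fun x => cutoff n (dilation κ t x)).HasTemperateGrowth :=
  hasTemperateGrowth_cutoff.comp (dilation κ t).hasTemperateGrowth

lemma exists_norm_iteratedFDeriv_cutoff_le (l : ℕ) :
    ∃ B : ℝ, 0 ≤ B ∧ ∀ i ≤ l, ∀ x, ‖iteratedFDeriv ℝ i (cutoff n) x‖ ≤ B := by
  let S : 𝓢(EuclideanSpace ℝ (Fin n), ℂ) := hasCompactSupport_cutoff.toSchwartzMap contDiff_cutoff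
  refine ⟨∑ i ∈ Finset.range (l + 1), SchwartzMap.seminorm ℝ 0 i S,
    Finset.sum_nonneg fun _ _ => apply_nonneg _ _, fun i hi x => ?_⟩
  refine (SchwartzMap.norm_iteratedFDeriv_le_seminorm ℝ S i x).trans ?_
  exact Finset.single_le_sum (f := fun i => SchwartzMap.seminorm ℝ 0 i S)
    (fun _ _ => apply_nonneg _ _) (by simpa [Nat.lt_succ_iff] using hi)

/-- The multiplier vanishes for `‖x‖ < R`, so one additional power of `‖x‖` in the seminorm of `χ`
is traded for `R⁻¹`. -/
lemma tendsto_seminorm_highPass (hκ : ∀ l, 0 < κ l) (χ : 𝓢(EuclideanSpace ℝ (Fin n), ℂ))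
    (k l : ℕ) :
    Tendsto (fun R : ℝ => SchwartzMap.seminorm ℂ k l
      (SchwartzMap.smulLeftCLM ℂ (fun x => 1 - cutoff n (dilation κ R⁻¹ x)) χ)) atTop (𝓝 0) := by
  obtain ⟨B, hB0, hB⟩ := exists_norm_iteratedFDeriv_cutoff_le (n := n) l
  set D : ℝ := ∑ i ∈ Finset.range (l + 1), SchwartzMap.seminorm ℂ (k + 1) i χ with hD
  have hD0 : 0 ≤ D := Finset.sum_nonneg fun _ _ => apply_nonneg _ _
  have hlim : Tendsto (fun R : ℝ => 2 ^ l * ((1 + B) * (D * R⁻¹))) atTop (𝓝 0) := by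
    have := ((tendsto_inv_atTop_zero (𝕜 := ℝ)).const_mul D).const_mul (1 + B)
    simpa using this.const_mul (2 ^ l)
  refine squeeze_zero' (Eventually.of_forall fun _ => apply_nonneg _ _) ?_ hlim
  filter_upwards [eventually_ge_atTop 1] with R hR
  have hR0 : 0 < R := by linarith
  have hr : R⁻¹ ≤ 1 := inv_le_one_of_one_le₀ hR
  have hsm : ContDiff ℝ ∞ (fun x => cutoff n (dilation κ R⁻¹ x)) :=
    contDiff_cutoff.comp (dilation κ R⁻¹).contDiff
  refine seminorm_smulLeftCLM_le (by
      have := hasTemperateGrowth_cutoff_dilation (κ := κ) R⁻¹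
      fun_prop) χ (by positivity) (by positivity) {x | R ≤ ‖x‖} ?_ ?_ ?_
  · intro i hi x
    rw [fun_iteratedFDeriv_sub_apply contDiffAt_const
      ((hsm.of_le (mod_cast le_top)).contDiffAt)]
    refine (norm_sub_le _ _).trans (add_le_add ?_ ?_)
    · rcases Nat.eq_zero_or_pos i with rfl | h
      · simp
      · rw [iteratedFDeriv_const_of_ne h.ne']; simp
    · refine (norm_iteratedFDeriv_comp_clm_le contDiff_cutoff _ _ _).trans ?_
      refine (mul_le_of_le_one_right (norm_nonneg _) ?_).trans (hB i hi _)
      exact pow_le_one₀ (norm_nonneg _) (norm_dilation_le_one hκ (by positivity) hr)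
  · intro i x hx
    have hx' : ‖x‖ < R := not_le.1 hx
    have : (fun x => 1 - cutoff n (dilation κ R⁻¹ x)) =ᶠ[𝓝 x] fun _ => 0 := by
      filter_upwards [continuous_norm.continuousAt.eventually_lt_const hx'] with y hy
      rw [cutoff_of_norm_le, sub_self]
      refine (norm_dilation_apply_le hκ (by positivity) hr y).trans ?_
      rw [inv_mul_le_iff₀ hR0]; linarith
    rw [(this.iteratedFDeriv ℝ i).eq_of_nhds]
    simp [show (fun _ : EuclideanSpace ℝ (Fin n) => (0 : ℂ)) = 0 from rfl]
  · intro i hi x hx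
    have h1 := SchwartzMap.le_seminorm ℂ (k + 1) i χ x
    have h2 : SchwartzMap.seminorm ℂ (k + 1) i χ ≤ D :=
      Finset.single_le_sum (f := fun i => SchwartzMap.seminorm ℂ (k + 1) i χ)
        (fun _ _ => apply_nonneg _ _) (by simpa [Nat.lt_succ_iff] using hi)
    rw [← div_eq_mul_inv, le_div_iff₀ hR0]
    calc _ ≤ ‖x‖ ^ k * ‖iteratedFDeriv ℝ i χ x‖ * ‖x‖ := by gcongr; exact hx
      _ = ‖x‖ ^ (k + 1) * ‖iteratedFDeriv ℝ i χ x‖ := by ring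
      _ ≤ D := h1.trans h2

/-- With `K = ∑ κ_j`, derivatives of the dilated cutoff cost up to `R^(K l)`, but the multiplier
lives on `‖x‖ ≤ 2/R`, where flatness yields `(2/R)^(K l + 1)`. The condition on `L` leaves this
exponent available after up to `l` derivatives of `χ`. -/
lemma tendsto_seminorm_lowPass (hκ : ∀ l, 0 < κ l) (χ : 𝓢(EuclideanSpace ℝ (Fin n), ℂ))
    (k l : ℕ) {L : ℕ} (hL : (∑ j, κ j) * l + 1 + l ≤ L)
    (hχ : ∀ i < L, iteratedFDeriv ℝ i χ 0 = 0) :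
    Tendsto (fun R : ℝ => SchwartzMap.seminorm ℂ k l
      (SchwartzMap.smulLeftCLM ℂ (fun x => cutoff n (dilation κ R x)) χ)) atTop (𝓝 0) := by
  obtain ⟨B, hB0, hB⟩ := exists_norm_iteratedFDeriv_cutoff_le (n := n) l
  set K := ∑ j, κ j with hK
  set D : ℝ := SchwartzMap.seminorm ℂ 0 L χ with hD
  have hD0 : 0 ≤ D := apply_nonneg _ _
  have hlim : Tendsto (fun R : ℝ => 2 ^ l * (B * D * 2 ^ (K * l + 1)) * R⁻¹) atTop (𝓝 0) := by
    simpa using (tendsto_inv_atTop_zero (𝕜 := ℝ)).const_mul (2 ^ l * (B * D * 2 ^ (K * l + 1)))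
  refine squeeze_zero' (Eventually.of_forall fun _ => apply_nonneg _ _) ?_ hlim
  filter_upwards [eventually_ge_atTop 2] with R hR
  have hR0 : 0 < R := by linarith
  have hR1 : 1 ≤ R := by linarith
  have := seminorm_smulLeftCLM_le (hasTemperateGrowth_cutoff_dilation (κ := κ) R) χ (k := k)
    (l := l) (A := B * R ^ (K * l)) (δ := D * (2 / R) ^ (K * l + 1)) (by positivity)
    (by positivity) {x | ‖x‖ ≤ 2 / R} ?_ ?_ ?_
  · refine this.trans_eq ?_
    rw [div_pow, pow_succ R]
    field_simp
  · intro i hi x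
    refine (norm_iteratedFDeriv_comp_clm_le contDiff_cutoff _ _ _).trans ?_
    gcongr
    · exact hB i hi _
    · refine (pow_le_pow_left₀ (norm_nonneg _) (norm_dilation_le hR1) i).trans ?_
      rw [← pow_mul]
      exact pow_le_pow_right₀ hR1 (Nat.mul_le_mul_left _ hi)
  · intro i x hx
    have hx' : 2 / R < ‖x‖ := not_le.1 hx
    have : (fun x => cutoff n (dilation κ R x)) =ᶠ[𝓝 x] fun _ => 0 := by
      filter_upwards [continuous_norm.continuousAt.eventually_const_lt hx'] with y hy
      rw [cutoff_of_le_norm]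
      refine le_trans ?_ (le_norm_dilation hκ hR1 y)
      rw [div_lt_iff₀ hR0] at hy; linarith
    rw [(this.iteratedFDeriv ℝ i).eq_of_nhds]
    simp [show (fun _ : EuclideanSpace ℝ (Fin n) => (0 : ℂ)) = 0 from rfl]
  · intro i hi x hx
    have hx' : ‖x‖ ≤ 2 / R := hx
    have h2 : 2 / R ≤ 1 := by rw [div_le_one hR0]; exact hR
    have h3 := norm_iteratedFDeriv_le_of_flat χ hχ (i := i) (by omega) x
    calc _ ≤ 1 * (D * ‖x‖ ^ (L - i)) := by
          gcongr
          exact pow_le_one₀ (norm_nonneg _) (hx'.trans h2)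
      _ ≤ D * (2 / R) ^ (K * l + 1) := by
          rw [one_mul]
          gcongr
          refine (pow_le_pow_left₀ (norm_nonneg _) hx' _).trans ?_
          exact pow_le_pow_of_le_one (by positivity) h2 (by omega)

/-- The band-pass cutoff `φ(δ_{2^{-J}} ξ) - φ(δ_{2^{J+1}} ξ)`. -/
def bandPass (κ : Fin n → ℕ) (J : ℕ) (x : EuclideanSpace ℝ (Fin n)) : ℂ :=
  cutoff n (dilation κ (2 ^ J)⁻¹ x) - cutoff n (dilation κ (2 ^ (J + 1)) x)

lemma hasTemperateGrowth_bandPass (J : ℕ) : (bandPass κ J).HasTemperateGrowth :=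
  (hasTemperateGrowth_cutoff_dilation _).sub (hasTemperateGrowth_cutoff_dilation _)

/-- A tempered distribution, tested against a function vanishing to high order at the origin, is
recovered from its band-pass truncations. -/
lemma exists_order_tendsto_bandPass (hκ : ∀ l, 0 < κ l)
    (T : 𝓢(EuclideanSpace ℝ (Fin n), ℂ) →L[ℂ] ℂ) :
    ∃ L : ℕ, ∀ χ : 𝓢(EuclideanSpace ℝ (Fin n), ℂ),
      (∀ i < L, iteratedFDeriv ℝ i χ 0 = 0) →
      Tendsto (fun J : ℕ => T (SchwartzMap.smulLeftCLM ℂ (bandPass κ J) χ)) atTop (𝓝 (T χ)) := by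
  obtain ⟨s, C, -, hC⟩ := Seminorm.bound_of_continuous
    (schwartz_withSeminorms ℂ (EuclideanSpace ℝ (Fin n)) ℂ)
    ((normSeminorm ℂ ℂ).comp T.toLinearMap) (continuous_norm.comp T.continuous)
  -- Finitely many seminorms dominate `T`; the largest flatness order that any of them demands of
  -- the low-pass estimate is taken.
  refine ⟨s.sup fun p => (∑ j, κ j) * p.2 + 1 + p.2, fun χ hχ => ?_⟩
  rw [tendsto_iff_norm_sub_tendsto_zero]
  set q : ℕ → ℕ × ℕ → ℝ := fun J p =>
    SchwartzMap.seminorm ℂ p.1 p.2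
      (SchwartzMap.smulLeftCLM ℂ (fun x => 1 - cutoff n (dilation κ (2 ^ J)⁻¹ x)) χ) +
    SchwartzMap.seminorm ℂ p.1 p.2
      (SchwartzMap.smulLeftCLM ℂ (fun x => cutoff n (dilation κ (2 ^ (J + 1)) x)) χ) with hq
  have hpow : Tendsto (fun J : ℕ => (2 : ℝ) ^ J) atTop atTop :=
    tendsto_pow_atTop_atTop_of_one_lt one_lt_two
  have hlim : Tendsto (fun J => C * ∑ p ∈ s, q J p) atTop (𝓝 0) := by
    have : Tendsto (fun J => ∑ p ∈ s, q J p) atTop (𝓝 (∑ p ∈ s, (0 : ℝ))) := by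
      refine tendsto_finsetSum _ fun p hp => ?_
      have h1 := (tendsto_seminorm_highPass hκ χ p.1 p.2).comp hpow
      have h2 := (tendsto_seminorm_lowPass hκ χ p.1 p.2
        (Finset.le_sup (f := fun p : ℕ × ℕ => (∑ j, κ j) * p.2 + 1 + p.2) hp) hχ).comp
        (hpow.comp (tendsto_add_atTop_nat 1))
      simpa using h1.add h2
    simpa using this.const_mul (C : ℝ)
  refine squeeze_zero (fun _ => norm_nonneg _) (fun J => ?_) hlim
  -- The error of the truncation is the sum of a high-pass and a low-pass part, both of which tend
  -- to zero.
  have hdec : SchwartzMap.smulLeftCLM ℂ (bandPass κ J) χ - χ =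
      -(SchwartzMap.smulLeftCLM ℂ (fun x => 1 - cutoff n (dilation κ (2 ^ J)⁻¹ x)) χ +
        SchwartzMap.smulLeftCLM ℂ (fun x => cutoff n (dilation κ (2 ^ (J + 1)) x)) χ) := by
    have h1 : (fun x => 1 - cutoff n (dilation κ (2 ^ J)⁻¹ x)).HasTemperateGrowth := by
      have := hasTemperateGrowth_cutoff_dilation (κ := κ) (2 ^ J)⁻¹
      fun_prop
    ext x
    rw [neg_apply, sub_apply, add_apply,
      SchwartzMap.smulLeftCLM_apply_apply (hasTemperateGrowth_bandPass J),
      SchwartzMap.smulLeftCLM_apply_apply h1,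
      SchwartzMap.smulLeftCLM_apply_apply (hasTemperateGrowth_cutoff_dilation _)]
    simp only [bandPass, smul_eq_mul]
    ring
  rw [← map_sub, hdec]
  refine (hC _).trans ?_
  rw [smul_apply, NNReal.smul_def, smul_eq_mul]
  gcongr
  rw [map_neg_eq_map]
  refine (Seminorm.finset_sup_le_sum (schwartzSeminormFamily ℂ _ _) s _).trans ?_
  rw [sum_apply]
  exact Finset.sum_le_sum fun p _ => map_add_le_add _ _ _

end cutoff

/-! ### Functionals concentrated at frequency zero are polynomials. -/

section polynomial

variable {n : ℕ}

lemma hasTemperateGrowth_coord (l : Fin n) :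
    (fun x : EuclideanSpace ℝ (Fin n) => (x l : ℂ)).HasTemperateGrowth :=
  Function.Complex.hasTemperateGrowth_ofReal.comp
    (EuclideanSpace.proj (𝕜 := ℝ) l : EuclideanSpace ℝ (Fin n) →L[ℝ] ℝ).hasTemperateGrowth

lemma hasTemperateGrowth_eval (Q : MvPolynomial (Fin n) ℂ) :
    (fun x : EuclideanSpace ℝ (Fin n) =>
      MvPolynomial.eval (fun l => (x l : ℂ)) Q).HasTemperateGrowth := by
  induction Q using MvPolynomial.induction_on with
  | C a => simp only [MvPolynomial.eval_C]; fun_prop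
  | add p q hp hq => simp only [map_add]; exact hp.add hq
  | mul_X p l hp =>
    simp only [map_mul, MvPolynomial.eval_X]; exact hp.mul (hasTemperateGrowth_coord l)

lemma lineDerivOp_single_fourierInv (φ : 𝓢(EuclideanSpace ℝ (Fin n), ℂ)) (l : Fin n) :
    ∂_{EuclideanSpace.single l (1 : ℝ)} (𝓕⁻ φ) =
      𝓕⁻ (SchwartzMap.smulLeftCLM ℂ
        (fun x => 2 * Real.pi * Complex.I * (x l : ℂ)) φ) := by
  have h1 : (fun x : EuclideanSpace ℝ (Fin n) =>
      inner ℝ x (EuclideanSpace.single l (1 : ℝ))).HasTemperateGrowth := by fun_prop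
  have h2 := hasTemperateGrowth_coord l
  rw [SchwartzMap.lineDerivOp_fourierInv_eq]
  congr 1
  ext x
  rw [smul_apply, SchwartzMap.smulLeftCLM_apply_apply h1,
    SchwartzMap.smulLeftCLM_apply_apply (by fun_prop)]
  simp [EuclideanSpace.inner_single_right, mul_assoc]

lemma exists_iteratedLineDerivOp_fourierInv (i : ℕ) (s : Fin i → Fin n) :
    ∃ Q : MvPolynomial (Fin n) ℂ, ∀ φ : 𝓢(EuclideanSpace ℝ (Fin n), ℂ),
      ∂^{fun j => EuclideanSpace.single (s j) (1 : ℝ)} (𝓕⁻ φ) =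
        𝓕⁻ (SchwartzMap.smulLeftCLM ℂ (fun x => MvPolynomial.eval (fun l => (x l : ℂ)) Q) φ) := by
  induction i with
  | zero =>
    refine ⟨1, fun φ => ?_⟩
    simp
  | succ i ih =>
    obtain ⟨Q, hQ⟩ := ih (Fin.tail s)
    refine ⟨MvPolynomial.C (2 * Real.pi * Complex.I) * MvPolynomial.X (s 0) * Q, fun φ => ?_⟩
    have h2 := hasTemperateGrowth_coord (s 0)
    rw [LineDeriv.iteratedLineDerivOp_succ_left]
    change ∂_{EuclideanSpace.single (s 0) (1 : ℝ)}
      (∂^{fun j => EuclideanSpace.single (Fin.tail s j) (1 : ℝ)} (𝓕⁻ φ)) = _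
    rw [hQ, lineDerivOp_single_fourierInv,
      SchwartzMap.smulLeftCLM_smulLeftCLM_apply (by fun_prop) (hasTemperateGrowth_eval Q)]
    simp only [map_mul, MvPolynomial.eval_C, MvPolynomial.eval_X]
    rfl

lemma fourierInv_apply_zero (φ : 𝓢(EuclideanSpace ℝ (Fin n), ℂ)) : (𝓕⁻ φ) 0 = ∫ x, φ x := by
  rw [SchwartzMap.fourierInv_coe, Real.fourierInv_eq]
  simp

/-- A functional on Schwartz functions vanishing on all functions that are flat to some fixed order
at the origin is the inverse Fourier transform of a polynomial. -/
lemma exists_polynomial_of_flat (T : 𝓢(EuclideanSpace ℝ (Fin n), ℂ) →ₗ[ℂ] ℂ) (L : ℕ)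
    (h : ∀ χ : 𝓢(EuclideanSpace ℝ (Fin n), ℂ),
      (∀ i < L, iteratedFDeriv ℝ i χ 0 = 0) → T χ = 0) :
    ∃ Q : MvPolynomial (Fin n) ℂ, ∀ χ : 𝓢(EuclideanSpace ℝ (Fin n), ℂ),
      T χ = ∫ x, (𝓕 χ) x * MvPolynomial.eval (fun l => (x l : ℂ)) Q := by
  let δ : (Σ i : Fin L, (Fin i → Fin n)) → 𝓢(EuclideanSpace ℝ (Fin n), ℂ) →ₗ[ℂ] ℂ := fun p =>
    { toFun := fun χ => (∂^{fun j => EuclideanSpace.single (p.2 j) (1 : ℝ)} χ) 0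
      map_add' := fun χ₁ χ₂ => by rw [LineDeriv.iteratedLineDerivOp_add]; rfl
      map_smul' := fun c χ => by rw [LineDeriv.iteratedLineDerivOp_smul]; rfl }
  -- Linear algebra, without continuity of `T`: if finitely many functionals jointly vanish only
  -- where `T` does, then `T` is a combination of them. A derivative vanishes at the origin once it
  -- vanishes on all tuples of basis vectors.
  have hspan : T ∈ Submodule.span ℂ (range δ) := by
    refine mem_span_of_iInf_ker_le_ker fun χ hχ => ?_
    rw [Submodule.mem_iInf] at hχ
    refine h χ fun i hi => ?_
    refine ContinuousMultilinearMap.toMultilinearMap_injective ?_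
    refine Module.Basis.ext_multilinear (fun _ => (EuclideanSpace.basisFun (Fin n) ℝ).toBasis)
      fun s => ?_
    have := hχ ⟨⟨i, hi⟩, s⟩
    rw [LinearMap.mem_ker] at this
    have h3 : (∂^{fun j => EuclideanSpace.single (s j) (1 : ℝ)} χ) 0 = 0 := this
    rw [SchwartzMap.iteratedLineDerivOp_eq_iteratedFDeriv] at h3
    simpa using h3
  choose Q hQ using fun p : Σ i : Fin L, (Fin i → Fin n) =>
    exists_iteratedLineDerivOp_fourierInv (p.1 : ℕ) p.2
  obtain ⟨c, hc⟩ := (Submodule.mem_span_range_iff_exists_fun ℂ).1 hspan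
  refine ⟨∑ p, MvPolynomial.C (c p) * Q p, fun χ => ?_⟩
  -- By Fourier inversion, a derivative of `χ` at the origin is a polynomial moment of `𝓕 χ`.
  have hint : ∀ p, δ p χ = ∫ x, MvPolynomial.eval (fun l => (x l : ℂ)) (Q p) * (𝓕 χ) x := fun p => by
    have h1 : δ p χ = (∂^{fun j => EuclideanSpace.single (p.2 j) (1 : ℝ)} (𝓕⁻ (𝓕 χ))) 0 := by
      rw [FourierTransform.fourierInv_fourier_eq]; rfl
    rw [h1, hQ, fourierInv_apply_zero]
    exact integral_congr_ae (Eventually.of_forall fun x => by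
      simp only [SchwartzMap.smulLeftCLM_apply_apply (hasTemperateGrowth_eval _), smul_eq_mul])
  have hI : ∀ p, Integrable fun x : EuclideanSpace ℝ (Fin n) =>
      MvPolynomial.eval (fun l => (x l : ℂ)) (Q p) * (𝓕 χ) x := fun p => by
    have := (SchwartzMap.smulLeftCLM ℂ (fun x : EuclideanSpace ℝ (Fin n) =>
      MvPolynomial.eval (fun l => (x l : ℂ)) (Q p)) (𝓕 χ)).integrable (μ := volume)
    refine this.congr (Eventually.of_forall fun x => ?_)
    simp only [SchwartzMap.smulLeftCLM_apply_apply (hasTemperateGrowth_eval _), smul_eq_mul]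
  rw [← hc]
  simp only [LinearMap.coe_sum, Finset.sum_apply, LinearMap.smul_apply, hint, smul_eq_mul]
  simp_rw [← integral_const_mul]
  rw [← integral_finsetSum _ fun p _ => (hI p).const_mul _]
  refine integral_congr_ae (Eventually.of_forall fun x => ?_)
  simp only [map_sum, map_mul, MvPolynomial.eval_C, Finset.mul_sum]
  exact Finset.sum_congr rfl fun p _ => by ring

end polynomial

/-! ### Quasi-homogeneous symbols and their coefficients. -/

section symbol

variable {n : ℕ} {κ : Fin n → ℕ} {m : ℕ}

/-- The finite set of multi-indices of weighted order `m`. -/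
def weightedIndices (κ : Fin n → ℕ) (m : ℕ) : Finset (Fin n → ℕ) :=
  (Fintype.piFinset fun _ => Finset.range (m + 1)).filter fun γ => weightedOrder κ γ = m

lemma mem_weightedIndices (hκ : ∀ l, 0 < κ l) {γ : Fin n → ℕ} :
    γ ∈ weightedIndices κ m ↔ weightedOrder κ γ = m := by
  simp only [weightedIndices, Finset.mem_filter, Fintype.mem_piFinset, Finset.mem_range,
    and_iff_right_iff_imp]
  rintro h l
  rw [Nat.lt_succ_iff, ← h, weightedOrder]
  exact (Nat.le_mul_of_pos_right _ (hκ l)).trans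
    (Finset.single_le_sum (f := fun l => γ l * κ l) (fun _ _ => Nat.zero_le _) (Finset.mem_univ l))

/-- The monomial `(iξ)^γ`. -/
def imagMonomial (γ : Fin n → ℕ) (ξ : EuclideanSpace ℝ (Fin n)) : ℂ :=
  ∏ l, (Complex.I * (ξ l : ℂ)) ^ γ l

lemma imagMonomial_add (γ γ' : Fin n → ℕ) (ξ : EuclideanSpace ℝ (Fin n)) :
    imagMonomial (γ + γ') ξ = imagMonomial γ ξ * imagMonomial γ' ξ := by
  simp [imagMonomial, pow_add, Finset.prod_mul_distrib]

lemma imagMonomial_dilation (γ : Fin n → ℕ) (t : ℝ) (ξ : EuclideanSpace ℝ (Fin n)) :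
    imagMonomial γ (dilation κ t ξ) = (t : ℂ) ^ weightedOrder κ γ * imagMonomial γ ξ := by
  rw [imagMonomial, imagMonomial, weightedOrder, ← Finset.prod_pow_eq_pow_sum,
    ← Finset.prod_mul_distrib]
  refine Finset.prod_congr rfl fun l _ => ?_
  rw [dilation_apply, mul_comm (γ l), pow_mul, ← mul_pow]
  push_cast
  ring

lemma contDiff_imagMonomial (γ : Fin n → ℕ) : ContDiff ℝ ∞ (imagMonomial γ) := by
  unfold imagMonomial
  refine contDiff_prod fun l _ => ContDiff.pow (contDiff_const.mul ?_) _
  exact Complex.ofRealCLM.contDiff.comp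
    (EuclideanSpace.proj (𝕜 := ℝ) l : EuclideanSpace ℝ (Fin n) →L[ℝ] ℝ).contDiff

/-- The quasi-homogeneous polynomial with coefficients `c`. -/
def homSymbol (c : weightedIndices κ m → ℂ) (ξ : EuclideanSpace ℝ (Fin n)) : ℂ :=
  ∑ γ, c γ * imagMonomial γ ξ

/-- Collecting the pairs with equal `α + β` places every admissible symbol in one finite-dimensional
space, where compactness is available. -/
lemma exists_homSymbol_eq_symbol (hκ : ∀ l, 0 < κ l) {𝒜 ℬ : Finset (Fin n → ℕ)}
    (h : ∀ α ∈ 𝒜, ∀ β ∈ ℬ, weightedOrder κ (α + β) = m)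
    (a : (Fin n → ℕ) → (Fin n → ℕ) → ℂ) :
    ∃ c : weightedIndices κ m → ℂ, homSymbol c = symbol 𝒜 ℬ a := by
  classical
  refine ⟨fun γ => ∑ α ∈ 𝒜, ∑ β ∈ ℬ, if α + β = γ then a α β else 0, ?_⟩
  ext ξ
  simp only [homSymbol, symbol, Finset.sum_mul]
  rw [Finset.sum_comm]
  refine Finset.sum_congr rfl fun α hα => ?_
  rw [Finset.sum_comm]
  refine Finset.sum_congr rfl fun β hβ => ?_
  rw [Finset.sum_eq_single ⟨α + β, (mem_weightedIndices hκ).2 (h α hα β hβ)⟩]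
  · simp [imagMonomial]
  · intro γ _ hγ
    rw [if_neg, zero_mul]
    rintro h
    exact hγ (Subtype.ext h.symm)
  · simp

lemma contDiff_homSymbol_uncurry :
    ContDiff ℝ ∞ fun p : (weightedIndices κ m → ℂ) × EuclideanSpace ℝ (Fin n) =>
      homSymbol p.1 p.2 := by
  unfold homSymbol
  refine ContDiff.sum fun γ _ => ContDiff.mul ?_ ((contDiff_imagMonomial _).comp contDiff_snd)
  exact (ContinuousLinearMap.proj (R := ℝ) (φ := fun _ : weightedIndices κ m => ℂ) γ).contDiff.comp
    contDiff_fst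

/-- A polynomial that vanishes on a product of infinite sets is zero. The cube is used because it is
compact. -/
lemma coeff_eq_zero_of_homSymbol_eq_zero {c : weightedIndices κ m → ℂ}
    (h : ∀ ξ : EuclideanSpace ℝ (Fin n), (∀ l, ξ l ∈ Icc (0 : ℝ) 1) → homSymbol c ξ = 0) :
    c = 0 := by
  classical
  set P : MvPolynomial (Fin n) ℂ := ∑ γ : weightedIndices κ m,
    MvPolynomial.monomial (Finsupp.equivFunOnFinite.symm γ.1)
      (c γ * ∏ l, Complex.I ^ γ.1 l) with hP
  have hP0 : P = 0 := by
    refine MvPolynomial.funext_set (fun _ => Complex.ofReal '' Icc (0 : ℝ) 1)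
      (fun _ => (Icc_infinite zero_lt_one).image Complex.ofReal_injective.injOn) fun x hx => ?_
    choose y hy hyx using fun l => hx l (mem_univ l)
    have := h (WithLp.toLp 2 y) hy
    rw [map_zero, ← this, hP, map_sum, homSymbol]
    refine Finset.sum_congr rfl fun γ _ => ?_
    rw [MvPolynomial.eval_monomial, imagMonomial, Finsupp.prod_fintype _ _ (by simp), mul_assoc,
      ← Finset.prod_mul_distrib]
    congr 1
    refine Finset.prod_congr rfl fun l _ => ?_
    simp [mul_pow, ← hyx]
  funext γ
  have h1 : MvPolynomial.coeff (Finsupp.equivFunOnFinite.symm γ.1) P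
      = c γ * ∏ l, Complex.I ^ γ.1 l := by
    rw [hP, MvPolynomial.coeff_sum, Finset.sum_eq_single γ]
    · simp
    · intro γ' _ hne
      rw [MvPolynomial.coeff_monomial, if_neg]
      intro heq
      exact hne (Subtype.ext (Finsupp.equivFunOnFinite.symm.injective heq))
    · simp
  rw [hP0, MvPolynomial.coeff_zero] at h1
  have h2 : ∏ l, Complex.I ^ γ.1 l ≠ 0 :=
    Finset.prod_ne_zero_iff.2 fun l _ => pow_ne_zero _ Complex.I_ne_zero
  simpa [h2] using h1.symm

/-- A bound on the symbol controls its coefficients. -/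
lemma exists_norm_coeff_le (κ : Fin n → ℕ) (m : ℕ) (Lam : ℝ) :
    ∃ R : ℝ, ∀ c : weightedIndices κ m → ℂ,
      (∀ ξ, ‖homSymbol c ξ‖ ≤ Lam * quasiNorm κ ξ ^ m) → ‖c‖ ≤ R := by
  set K : Set (EuclideanSpace ℝ (Fin n)) := WithLp.toLp 2 '' (univ.pi fun _ => Icc (0 : ℝ) 1)
    with hK
  have hKc : IsCompact K :=
    (isCompact_univ_pi fun _ => isCompact_Icc).image (PiLp.continuous_toLp 2 _)
  have : CompactSpace K := isCompact_iff_compactSpace.1 hKc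
  have hcont : ∀ c : weightedIndices κ m → ℂ, Continuous (homSymbol c) := fun c =>
    contDiff_homSymbol_uncurry.continuous.comp (Continuous.prodMk_right c)
  let Φ : (weightedIndices κ m → ℂ) →ₗ[ℂ] C(K, ℂ) :=
    { toFun := fun c => ⟨fun ξ => homSymbol c ξ, (hcont c).comp continuous_subtype_val⟩
      map_add' := fun c c' => by
        ext ξ; simp [homSymbol, add_mul, Finset.sum_add_distrib]
      map_smul' := fun a c => by
        ext ξ; simp [homSymbol, Finset.mul_sum, mul_assoc] }
  have hker : LinearMap.ker Φ = ⊥ := by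
    refine LinearMap.ker_eq_bot'.2 fun c hc => coeff_eq_zero_of_homSymbol_eq_zero fun ξ hξ => ?_
    have hξK : ξ ∈ K := ⟨ξ.ofLp, fun l _ => hξ l, rfl⟩
    have h : (Φ c) ⟨ξ, hξK⟩ = 0 := by rw [hc]; rfl
    exact h
  -- An injective linear map on a finite-dimensional space is bounded below, so the supremum over
  -- the cube controls the coefficients.
  obtain ⟨A, -, hA⟩ := Φ.exists_antilipschitzWith hker
  obtain ⟨D, hD⟩ := hKc.exists_bound_of_continuousOn
    ((continuous_quasiNorm (κ := κ)).pow m).continuousOn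
  refine ⟨A * (|Lam| * |D|), fun c hc => ?_⟩
  have h1 := hA.le_mul_norm (map_zero Φ) c
  refine h1.trans ?_
  gcongr
  refine (ContinuousMap.norm_le _ (by positivity)).2 fun ξ => ?_
  refine (hc ξ).trans ?_
  have h2 := (hD ξ ξ.2).trans (le_abs_self D)
  calc Lam * quasiNorm κ ξ ^ m ≤ |Lam| * ‖quasiNorm κ ξ ^ m‖ := by
        have h3 : 0 ≤ quasiNorm κ ξ.1 ^ m := pow_nonneg (quasiNorm_nonneg _) m
        rw [Real.norm_of_nonneg h3]
        exact mul_le_mul_of_nonneg_right (le_abs_self _) h3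
    _ ≤ _ := mul_le_mul_of_nonneg_left h2 (abs_nonneg _)

end symbol

/-! ### A globally smooth reciprocal and uniform bounds over compact parameter sets. -/

section smoothInv

/-- A smooth function which agrees with `z⁻¹` for `r ≤ ‖z‖`. -/
def smoothInv (r : ℝ) (z : ℂ) : ℂ :=
  if hr : 0 < r then
    (‖z‖ ^ 2 + (⟨r / 2, r, half_pos hr, half_lt_self hr⟩ : ContDiffBump (0 : ℂ)) z)⁻¹ •
      (starRingEnd ℂ) z
  else 0

lemma smoothInv_of_le {r : ℝ} (hr : 0 < r) {z : ℂ} (hz : r ≤ ‖z‖) : smoothInv r z = z⁻¹ := by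
  rw [smoothInv, dif_pos hr, ContDiffBump.zero_of_le_dist _ (by simpa using hz), add_zero,
    Complex.inv_def, Complex.normSq_eq_norm_sq, Complex.real_smul, mul_comm]

/-- The denominator is positive: `‖z‖²` handles `z ≠ 0`, the bump handles `z = 0`. Smoothness on all
of `ℂ` lets the coefficients range over a full ball, including values whose symbol has zeros. -/
lemma contDiff_smoothInv {r : ℝ} (hr : 0 < r) : ContDiff ℝ ∞ (smoothInv r) := by
  have : smoothInv r = fun z =>
      (‖z‖ ^ 2 + (⟨r / 2, r, half_pos hr, half_lt_self hr⟩ : ContDiffBump (0 : ℂ)) z)⁻¹ •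
        (starRingEnd ℂ) z := by
    ext z; rw [smoothInv, dif_pos hr]
  rw [this]
  refine ContDiff.smul (ContDiff.inv ((contDiff_norm_sq ℝ).add (ContDiffBump.contDiff _)) ?_)
    Complex.conjCLE.contDiff
  intro z
  by_cases hz : z = 0
  · rw [hz, ContDiffBump.one_of_mem_closedBall _ (by simp; positivity)]
    simp
  · exact (add_pos_of_pos_of_nonneg (by positivity) (ContDiffBump.nonneg _)).ne'

end smoothInv

section uniform

variable {V E : Type*} [NormedAddCommGroup V] [NormedSpace ℝ V] [NormedAddCommGroup E]
  [NormedSpace ℝ E] [ProperSpace V] [ProperSpace E]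

lemma exists_uniform_decay {H : V × E → ℂ} (hH : ContDiff ℝ ∞ H) {ρ : ℝ}
    (hsupp : ∀ c ξ, ρ ≤ ‖ξ‖ → H (c, ξ) = 0) (R : ℝ) (k l : ℕ) :
    ∃ B : ℝ, ∀ c, ‖c‖ ≤ R → ∀ ξ, ‖ξ‖ ^ k * ‖iteratedFDeriv ℝ l (fun ξ => H (c, ξ)) ξ‖ ≤ B := by
  obtain ⟨D, hD⟩ := ((isCompact_closedBall (0 : V) R).prod
    (isCompact_closedBall (0 : E) ρ)).exists_bound_of_continuousOn
    (hH.continuous_iteratedFDeriv (m := l) (mod_cast le_top)).continuousOn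
  refine ⟨|ρ| ^ k * |D|, fun c hc ξ => ?_⟩
  by_cases hξ : ‖ξ‖ ≤ ρ
  -- After translation by `(c, 0)`, the partial function is the joint one composed with the linear
  -- inclusion of the second factor, so joint derivatives bound the partial ones.
  · have h0 : ContDiff ℝ ∞ (fun p : V × E => H ((c, 0) + p)) := hH.comp (contDiff_const.add contDiff_id)
    have h1 := norm_iteratedFDeriv_comp_clm_le h0 (ContinuousLinearMap.inr ℝ V E) l ξ
    rw [iteratedFDeriv_comp_add_left] at h1
    simp only [ContinuousLinearMap.inr_apply, Prod.mk_add_mk, add_zero, zero_add] at h1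
    have h2 : ‖ContinuousLinearMap.inr ℝ V E‖ ^ l ≤ 1 :=
      pow_le_one₀ (norm_nonneg _) (ContinuousLinearMap.norm_inr_le_one ℝ V E)
    gcongr
    · exact hξ.trans (le_abs_self _)
    · refine h1.trans ((mul_le_of_le_one_right (norm_nonneg _) h2).trans ?_)
      exact (hD (c, ξ) ⟨by simpa using hc, by simpa using hξ⟩).trans (le_abs_self D)
  · have : (fun ξ => H (c, ξ)) =ᶠ[𝓝 ξ] fun _ => 0 := by
      filter_upwards [continuous_norm.continuousAt.eventually_const_lt (not_le.1 hξ)] with y hy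
      exact hsupp c y hy.le
    rw [(this.iteratedFDeriv ℝ l).eq_of_nhds]
    simp [show (fun _ : E => (0 : ℂ)) = 0 from rfl]
    positivity

end uniform

/-- A continuous linear map sends bounded sets to bounded sets; this carries uniform bounds from
multipliers to kernels. -/
lemma exists_seminorm_fourierInv_le {n : ℕ} {S : Set 𝓢(EuclideanSpace ℝ (Fin n), ℂ)}
    (hS : ∀ k l, ∃ B : ℝ, ∀ f ∈ S, SchwartzMap.seminorm ℂ k l f ≤ B) (k l : ℕ) :
    ∃ B : ℝ, ∀ f ∈ S, SchwartzMap.seminorm ℂ k l (𝓕⁻ f) ≤ B := by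
  choose B hB using hS
  let F : 𝓢(EuclideanSpace ℝ (Fin n), ℂ) →L[ℂ] 𝓢(EuclideanSpace ℝ (Fin n), ℂ) :=
    FourierTransform.fourierInvCLM ℂ _
  have hF : Continuous ((SchwartzMap.seminorm ℂ k l).comp F.toLinearMap) :=
    ((schwartz_withSeminorms ℂ (EuclideanSpace ℝ (Fin n)) ℂ).continuous_seminorm (k, l)).comp
      F.continuous
  obtain ⟨s, C, -, hC⟩ := Seminorm.bound_of_continuous
    (schwartz_withSeminorms ℂ (EuclideanSpace ℝ (Fin n)) ℂ) _ hF
  refine ⟨C * ∑ p ∈ s, B p.1 p.2, fun f hf => (hC f).trans ?_⟩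
  rw [smul_apply, NNReal.smul_def, smul_eq_mul]
  gcongr
  refine (Seminorm.finset_sup_le_sum (schwartzSeminormFamily ℂ _ _) s _).trans ?_
  rw [sum_apply]
  exact Finset.sum_le_sum fun p _ => hB p.1 p.2 f hf

/-! ### Dyadic annuli and the kernels of the solution operator. -/

section kernel

variable {n : ℕ} {κ : Fin n → ℕ} {m : ℕ}

/-- The dyadic annular cutoff `φ(ξ) - φ(δ_2 ξ)`. -/
def annulus (κ : Fin n → ℕ) (ξ : EuclideanSpace ℝ (Fin n)) : ℂ :=
  cutoff n ξ - cutoff n (dilation κ 2 ξ)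

lemma annulus_zero : annulus κ 0 = 0 := by simp [annulus]

lemma annulus_of_le_norm (hκ : ∀ l, 0 < κ l) {ξ : EuclideanSpace ℝ (Fin n)} (h : 2 ≤ ‖ξ‖) :
    annulus κ ξ = 0 := by
  rw [annulus, cutoff_of_le_norm h, cutoff_of_le_norm, sub_zero]
  have := le_norm_dilation hκ one_le_two ξ
  linarith

lemma contDiff_annulus : ContDiff ℝ ∞ (annulus κ) :=
  contDiff_cutoff.sub (contDiff_cutoff.comp (dilation κ 2).contDiff)

/-- The sum telescopes. -/
lemma sum_annulus_dilation (J : ℕ) (ξ : EuclideanSpace ℝ (Fin n)) :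
    ∑ j ∈ Finset.Icc (-J : ℤ) J, annulus κ (dilation κ (2 ^ j) ξ) = bandPass κ J ξ := by
  have key : ∀ j : ℤ, annulus κ (dilation κ (2 ^ j) ξ) =
      cutoff n (dilation κ (2 ^ j) ξ) - cutoff n (dilation κ (2 ^ (j + 1)) ξ) := fun j => by
    rw [annulus, dilation_dilation, zpow_add_one₀ two_ne_zero, mul_comm]
  induction J with
  | zero =>
    simp [key, bandPass]
  | succ J ih =>
    have h1 : Finset.Icc (-(J + 1 : ℕ) : ℤ) (J + 1 : ℕ) =
        insert (-(J + 1 : ℕ) : ℤ) (insert ((J + 1 : ℕ) : ℤ) (Finset.Icc (-J : ℤ) J)) := by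
      ext j; simp only [Finset.mem_Icc, Finset.mem_insert]; omega
    have h2 : ((J + 1 : ℕ) : ℤ) ∉ Finset.Icc (-J : ℤ) J := by
      simp only [Finset.mem_Icc]; omega
    have h3 : (-(J + 1 : ℕ) : ℤ) ∉ insert ((J + 1 : ℕ) : ℤ) (Finset.Icc (-J : ℤ) J) := by
      simp only [Finset.mem_Icc, Finset.mem_insert]; omega
    rw [h1, Finset.sum_insert h3, Finset.sum_insert h2, ih, key, key]
    simp only [bandPass]
    have e1 : (2 : ℝ) ^ (-((J + 1 : ℕ) : ℤ)) = (2 ^ (J + 1))⁻¹ := by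
      rw [zpow_neg, zpow_natCast]
    have e2 : (2 : ℝ) ^ (-((J + 1 : ℕ) : ℤ) + 1) = (2 ^ J)⁻¹ := by
      rw [← zpow_natCast, ← zpow_neg]; congr 1; push_cast; ring
    have e3 : (2 : ℝ) ^ (((J + 1 : ℕ) : ℤ)) = 2 ^ (J + 1) := zpow_natCast _ _
    have e4 : (2 : ℝ) ^ (((J + 1 : ℕ) : ℤ) + 1) = 2 ^ (J + 1 + 1) := by
      rw [← zpow_natCast]; rfl
    rw [e1, e2, e3, e4]
    ring

lemma quasiNorm_smul_ge {s : ℝ} (hs : 1 ≤ s) (ξ : EuclideanSpace ℝ (Fin n)) :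
    quasiNorm κ ξ ≤ quasiNorm κ (s • ξ) := by
  refine Real.sqrt_le_sqrt (Finset.sum_le_sum fun l _ => ?_)
  refine Real.rpow_le_rpow (abs_nonneg _) ?_ (by positivity)
  rw [PiLp.smul_apply, smul_eq_mul, abs_mul]
  exact le_mul_of_one_le_left (abs_nonneg _) (hs.trans (le_abs_self s))

/-- If `‖δ_2 ξ‖ ≤ 1`, both cutoffs equal one and cancel. Hence `ξ` stays away from the origin, which
makes the lower bound on the symbol effective. -/
lemma quasiNorm_ge_of_annulus_ne_zero (hκ : ∀ l, 0 < κ l) {ξ : EuclideanSpace ℝ (Fin n)}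
    (h : annulus κ ξ ≠ 0) : (1 / (2 * (n + 1)) : ℝ) ≤ quasiNorm κ ξ := by
  have h1 : 1 < ‖dilation κ 2 ξ‖ := by
    by_contra! h1
    refine h ?_
    have := le_norm_dilation hκ one_le_two ξ
    rw [annulus, cutoff_of_norm_le h1, cutoff_of_norm_le (by linarith [norm_nonneg ξ]), sub_self]
  have h2 := quasiNorm_dilation hκ zero_le_two ξ
  have hn : (0 : ℝ) ≤ n := Nat.cast_nonneg n
  rw [div_le_iff₀ (by positivity)]
  by_cases h3 : quasiNorm κ (dilation κ 2 ξ) ≤ 1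
  · have h4 := norm_le_of_quasiNorm_le_one hκ h3
    have h5 := quasiNorm_nonneg (κ := κ) ξ
    rw [h2] at h4
    nlinarith
  · rw [h2] at h3
    nlinarith

/-- The cut-off reciprocal of the symbol at frequency `ξ` (with Mathlib's `2π` convention). -/
def cutReciprocal (κ : Fin n → ℕ) (r : ℝ) (p : EuclideanSpace ℝ (Fin n) → ℂ)
    (ξ : EuclideanSpace ℝ (Fin n)) : ℂ :=
  annulus κ ξ * smoothInv r (p ((2 * Real.pi) • ξ))

/-- The lower bound of the symbol on the support of the annular cutoff. -/
def symbolLowerBound (n m : ℕ) (lam : ℝ) : ℝ := lam * (1 / (2 * (n + 1)) : ℝ) ^ m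

lemma symbolLowerBound_pos {lam : ℝ} (h : 0 < lam) : 0 < symbolLowerBound n m lam := by
  unfold symbolLowerBound; positivity

/-- On the support of the annulus `smoothInv` is the true inverse, and homogeneity supplies the
factor `t^m`. This is the only form in which division by the symbol occurs. -/
lemma mul_cutReciprocal_dilation (hκ : ∀ l, 0 < κ l) {lam : ℝ} (hlam : 0 < lam)
    {p : EuclideanSpace ℝ (Fin n) → ℂ} (hp : ∀ ξ, lam * quasiNorm κ ξ ^ m ≤ ‖p ξ‖)
    (hom : ∀ (t : ℝ) ξ, p (dilation κ t ξ) = (t : ℂ) ^ m * p ξ) (t : ℝ)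
    (ξ : EuclideanSpace ℝ (Fin n)) :
    p ((2 * Real.pi) • ξ) * ((t : ℂ) ^ m *
      cutReciprocal κ (symbolLowerBound n m lam) p (dilation κ t ξ)) =
        annulus κ (dilation κ t ξ) := by
  by_cases h : annulus κ (dilation κ t ξ) = 0
  · simp [cutReciprocal, h]
  have hr := symbolLowerBound_pos (n := n) (m := m) hlam
  have h1 : symbolLowerBound n m lam ≤ ‖p ((2 * Real.pi) • dilation κ t ξ)‖ := by
    refine le_trans ?_ (hp _)
    unfold symbolLowerBound
    gcongr
    exact (quasiNorm_ge_of_annulus_ne_zero hκ h).trans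
      (quasiNorm_smul_ge (by linarith [Real.pi_gt_three]) _)
  have h2 : p ((2 * Real.pi) • dilation κ t ξ) ≠ 0 := norm_pos_iff.1 (hr.trans_le h1)
  rw [cutReciprocal, smoothInv_of_le hr h1]
  rw [← map_smul, hom] at h2 ⊢
  obtain ⟨h3, h4⟩ := mul_ne_zero_iff.1 h2
  field_simp

lemma contDiff_multiplier_uncurry {r : ℝ} (hr : 0 < r) (γ : Fin n → ℕ) :
    ContDiff ℝ ∞ fun q : (weightedIndices κ m → ℂ) × EuclideanSpace ℝ (Fin n) =>
      imagMonomial γ ((2 * Real.pi) • q.2) * cutReciprocal κ r (homSymbol q.1) q.2 := by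
  have hs : ContDiff ℝ ∞ fun q : (weightedIndices κ m → ℂ) × EuclideanSpace ℝ (Fin n) =>
      (2 * Real.pi) • q.2 := contDiff_snd.const_smul _
  refine ((contDiff_imagMonomial γ).comp hs).mul ?_
  refine (contDiff_annulus.comp contDiff_snd).mul ((contDiff_smoothInv hr).comp ?_)
  exact contDiff_homSymbol_uncurry.comp (contDiff_fst.prodMk hs)

lemma homSymbol_dilation (hκ : ∀ l, 0 < κ l) (c : weightedIndices κ m → ℂ) (t : ℝ)
    (ξ : EuclideanSpace ℝ (Fin n)) :
    homSymbol c (dilation κ t ξ) = (t : ℂ) ^ m * homSymbol c ξ := by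
  simp only [homSymbol, Finset.mul_sum]
  refine Finset.sum_congr rfl fun γ _ => ?_
  rw [imagMonomial_dilation, (mem_weightedIndices hκ).1 γ.2]
  ring

lemma one_add_norm_pow_mul_le {S : Set 𝓢(EuclideanSpace ℝ (Fin n), ℂ)}
    (hS : ∀ k l, ∃ B : ℝ, ∀ f ∈ S, SchwartzMap.seminorm ℂ k l f ≤ B) (k l : ℕ) :
    ∃ B : ℝ, ∀ f ∈ S, ∀ x, (1 + ‖x‖) ^ k * ‖iteratedFDeriv ℝ l f x‖ ≤ B := by
  choose B hB using hS
  refine ⟨2 ^ k * ∑ p ∈ Finset.Iic (k, l), B p.1 p.2, fun f hf x => ?_⟩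
  refine (SchwartzMap.one_add_le_sup_seminorm_apply (𝕜 := ℂ) (m := (k, l)) le_rfl le_rfl f
    x).trans ?_
  gcongr
  refine (Seminorm.finset_sup_le_sum
    (schwartzSeminormFamily ℂ (EuclideanSpace ℝ (Fin n)) ℂ) (Finset.Iic (k, l)) _).trans ?_
  rw [sum_apply]
  exact Finset.sum_le_sum fun p _ => hB p.1 p.2 f hf

/-- The kernels of the dyadic pieces of the solution operator, bounded uniformly over all symbols
with the given ellipticity constants. -/
lemma exists_kernels (hκ : ∀ l, 0 < κ l) (m : ℕ) {lam : ℝ} (hlam : 0 < lam) (Lam : ℝ) (L : ℕ) :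
    ∃ B : ℝ, ∀ c : weightedIndices κ m → ℂ,
      (∀ ξ, ‖homSymbol c ξ‖ ≤ Lam * quasiNorm κ ξ ^ m) →
      ∀ γ ∈ weightedIndices κ m, ∃ k : 𝓢(EuclideanSpace ℝ (Fin n), ℂ),
        (∀ ξ, (𝓕 k) ξ = imagMonomial γ ((2 * Real.pi) • ξ) *
          cutReciprocal κ (symbolLowerBound n m lam) (homSymbol c) ξ) ∧
        ∀ y, (1 + ‖y‖) ^ L * ‖k y‖ ≤ B ∧ (1 + ‖y‖) ^ L * ‖fderiv ℝ k y‖ ≤ B := by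
  have hr := symbolLowerBound_pos (n := n) (m := m) hlam
  obtain ⟨R, hR⟩ := exists_norm_coeff_le κ m Lam
  let H : (Fin n → ℕ) → (weightedIndices κ m → ℂ) × EuclideanSpace ℝ (Fin n) → ℂ := fun γ q =>
    imagMonomial γ ((2 * Real.pi) • q.2) *
      cutReciprocal κ (symbolLowerBound n m lam) (homSymbol q.1) q.2
  have hH : ∀ γ, ContDiff ℝ ∞ (H γ) := fun γ => contDiff_multiplier_uncurry hr γ
  have hsupp : ∀ γ c ξ, 2 ≤ ‖ξ‖ → H γ (c, ξ) = 0 := fun γ c ξ h => by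
    simp [H, cutReciprocal, annulus_of_le_norm hκ h]
  have hcs : ∀ γ c, HasCompactSupport fun ξ => H γ (c, ξ) := fun γ c =>
    HasCompactSupport.of_support_subset_isCompact (isCompact_closedBall 0 2) fun ξ hξ => by
      by_contra h
      exact hξ (hsupp γ c ξ (le_of_lt (by simpa using h)))
  have hsm : ∀ γ c, ContDiff ℝ ∞ fun ξ => H γ (c, ξ) := fun γ c =>
    (hH γ).comp (contDiff_const.prodMk contDiff_id)
  let M : (Fin n → ℕ) → (weightedIndices κ m → ℂ) → 𝓢(EuclideanSpace ℝ (Fin n), ℂ) :=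
    fun γ c => (hcs γ c).toSchwartzMap (hsm γ c)
  -- All coefficients in the ball are admitted, elliptic or not: `smoothInv` makes the lower bound
  -- unnecessary here.
  let S : Set 𝓢(EuclideanSpace ℝ (Fin n), ℂ) :=
    {f | ∃ γ ∈ weightedIndices κ m, ∃ c, ‖c‖ ≤ R ∧ f = M γ c}
  have hS : ∀ k l, ∃ B : ℝ, ∀ f ∈ S, SchwartzMap.seminorm ℂ k l f ≤ B := fun k l => by
    choose b hb using fun γ => exists_uniform_decay (hH γ) (hsupp γ) R k l
    refine ⟨∑ γ ∈ weightedIndices κ m, |b γ|, ?_⟩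
    rintro f ⟨γ, hγ, c, hc, rfl⟩
    refine SchwartzMap.seminorm_le_bound ℂ k l _
      (Finset.sum_nonneg fun _ _ => abs_nonneg _) fun ξ => ?_
    refine (hb γ c hc ξ).trans ((le_abs_self _).trans ?_)
    exact Finset.single_le_sum (f := fun γ => |b γ|) (fun _ _ => abs_nonneg _) hγ
  have hS' : ∀ k l, ∃ B : ℝ, ∀ f ∈ (fun f => 𝓕⁻ f) '' S, SchwartzMap.seminorm ℂ k l f ≤ B :=
    fun k l => by
      obtain ⟨B, hB⟩ := exists_seminorm_fourierInv_le hS k l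
      refine ⟨B, ?_⟩
      rintro _ ⟨f, hf, rfl⟩
      exact hB f hf
  obtain ⟨B₀, hB₀⟩ := one_add_norm_pow_mul_le hS' L 0
  obtain ⟨B₁, hB₁⟩ := one_add_norm_pow_mul_le hS' L 1
  refine ⟨max B₀ B₁, fun c hc γ hγ => ⟨𝓕⁻ (M γ c), fun ξ => ?_, fun y => ⟨?_, ?_⟩⟩⟩
  · rw [FourierTransform.fourier_fourierInv_eq]; rfl
  · have := hB₀ _ ⟨M γ c, ⟨γ, hγ, c, hR c hc, rfl⟩, rfl⟩ y
    rw [norm_iteratedFDeriv_zero] at this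
    exact this.trans (le_max_left _ _)
  · have := hB₁ _ ⟨M γ c, ⟨γ, hγ, c, hR c hc, rfl⟩, rfl⟩ y
    rw [norm_iteratedFDeriv_one] at this
    exact this.trans (le_max_right _ _)

end kernel

/-! ### Size and increments of the dyadic pieces. -/

section piece

variable {n : ℕ} {κ : Fin n → ℕ}

/-- The integrable weight `(1 + ‖y‖)^{-(n+1)}`. -/
def weight (n : ℕ) (y : EuclideanSpace ℝ (Fin n)) : ℝ := ((1 + ‖y‖) ^ (n + 1))⁻¹

lemma weight_nonneg (y : EuclideanSpace ℝ (Fin n)) : 0 ≤ weight n y := by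
  unfold weight; positivity

lemma integrable_weight : Integrable (weight n) := by
  have := integrable_one_add_norm (E := EuclideanSpace ℝ (Fin n)) (μ := volume) (r := (n + 1 : ℕ))
    (by simp)
  refine this.congr (Eventually.of_forall fun y => ?_)
  simp only [weight]
  rw [Real.rpow_neg (by positivity), Real.rpow_natCast]

lemma exists_norm_mul_pow_le_weight (k : 𝓢(EuclideanSpace ℝ (Fin n), ℂ)) (N : ℕ) :
    ∃ C : ℝ, ∀ y, ‖k y‖ * (1 + ‖y‖) ^ N ≤ C * weight n y := by
  refine ⟨2 ^ (N + (n + 1)) * (Finset.Iic (N + (n + 1), 0)).sup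
    (fun m => SchwartzMap.seminorm ℂ m.1 m.2) k, fun y => ?_⟩
  rw [weight, ← div_eq_mul_inv, le_div_iff₀ (by positivity), mul_assoc, ← pow_add, mul_comm]
  have := SchwartzMap.one_add_le_sup_seminorm_apply (𝕜 := ℂ) (m := (N + (n + 1), 0)) le_rfl le_rfl
    k y
  rwa [norm_iteratedFDeriv_zero] at this

lemma PolynomialGrowth.integrable_mul {h : EuclideanSpace ℝ (Fin n) → ℂ}
    (hh : PolynomialGrowth h) (hc : Continuous h) (k : 𝓢(EuclideanSpace ℝ (Fin n), ℂ)) :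
    Integrable fun y => k y * h y := by
  obtain ⟨K, N, hK⟩ := hh
  obtain ⟨C, hC⟩ := exists_norm_mul_pow_le_weight k N
  refine (integrable_weight.const_mul (|K| * C)).mono'
    (k.continuous.mul hc).aestronglyMeasurable (Eventually.of_forall fun y => ?_)
  rw [norm_mul]
  calc ‖k y‖ * ‖h y‖ ≤ ‖k y‖ * (|K| * (1 + ‖y‖) ^ N) := by
        gcongr
        exact (hK y).trans (by gcongr; exact le_abs_self K)
    _ = |K| * (‖k y‖ * (1 + ‖y‖) ^ N) := by ring
    _ ≤ |K| * C * weight n y := by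
        rw [mul_assoc]; exact mul_le_mul_of_nonneg_left (hC y) (abs_nonneg K)

lemma one_add_norm_sub_dilation_le (t : ℝ) (x y : EuclideanSpace ℝ (Fin n)) :
    1 + ‖x - dilation κ t y‖ ≤ (1 + ‖x‖) * ((1 + ‖dilation κ t‖) * (1 + ‖y‖)) := by
  have h1 := (norm_sub_le x (dilation κ t y)).trans
    (add_le_add le_rfl ((dilation κ t).le_opNorm y))
  nlinarith [norm_nonneg x, norm_nonneg y, norm_nonneg (dilation κ t),
    mul_nonneg (norm_nonneg x) (norm_nonneg y),
    mul_nonneg (norm_nonneg x) (norm_nonneg (dilation κ t)),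
    mul_nonneg (norm_nonneg (dilation κ t)) (norm_nonneg y),
    mul_nonneg (mul_nonneg (norm_nonneg x) (norm_nonneg (dilation κ t))) (norm_nonneg y)]

lemma PolynomialGrowth.comp_sub_dilation {h : EuclideanSpace ℝ (Fin n) → ℂ}
    (hh : PolynomialGrowth h) (t : ℝ) (x : EuclideanSpace ℝ (Fin n)) :
    PolynomialGrowth fun y => h (x - dilation κ t y) := by
  obtain ⟨K, N, hK⟩ := hh
  refine ⟨|K| * ((1 + ‖x‖) * (1 + ‖dilation κ t‖)) ^ N, N, fun y => ?_⟩
  refine (hK _).trans ?_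
  rw [mul_assoc, ← mul_pow]
  gcongr
  · exact le_abs_self K
  · exact (one_add_norm_sub_dilation_le t x y).trans_eq (by ring)

variable {ℬ : Finset (Fin n → ℕ)} {f : (Fin n → ℕ) → EuclideanSpace ℝ (Fin n) → ℂ}

/-- The dyadic piece `x ↦ ∑_β ∫ k_β(y) f_β(x - δ_t y) dy`. -/
def piece (κ : Fin n → ℕ) (ℬ : Finset (Fin n → ℕ))
    (k : (Fin n → ℕ) → 𝓢(EuclideanSpace ℝ (Fin n), ℂ))
    (f : (Fin n → ℕ) → EuclideanSpace ℝ (Fin n) → ℂ) (t : ℝ) (x : EuclideanSpace ℝ (Fin n)) : ℂ :=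
  ∑ β ∈ ℬ, ∫ y, k β y * f β (x - dilation κ t y)

lemma sum_norm_sub_dilation_le (hκ : ∀ l, 0 < κ l) {t : ℝ} (ht : 0 < t)
    (hω : oscillation κ ℬ f t ≠ ⊤) (x y : EuclideanSpace ℝ (Fin n)) :
    ∑ β ∈ ℬ, ‖f β (x - dilation κ t y) - f β x‖
      ≤ growthConst κ * (1 + ‖y‖) * (oscillation κ ℬ f t).toReal := by
  have h0 : 0 ≤ growthConst κ * (1 + ‖y‖) := mul_nonneg growthConst_nonneg (by positivity)
  have := ENNReal.toReal_mono (ENNReal.mul_ne_top ENNReal.ofReal_ne_top hω)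
    (sum_enorm_sub_dilation_le (ℬ := ℬ) (f := f) hκ ht x y)
  rw [ENNReal.toReal_mul, ENNReal.toReal_ofReal h0, ENNReal.toReal_sum (by simp)] at this
  simpa using this

/-- As `k_β` has mean zero, `f_β(x)` may be subtracted under the integral. Of the `n + 2` powers of
decay, `n + 1` give integrability and one pays for the linear growth in `sum_norm_sub_dilation_le`.
-/
lemma norm_piece_le (hκ : ∀ l, 0 < κ l) {k : (Fin n → ℕ) → 𝓢(EuclideanSpace ℝ (Fin n), ℂ)}
    (hf : ∀ β ∈ ℬ, Continuous (f β) ∧ PolynomialGrowth (f β)) {t : ℝ} (ht : 0 < t)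
    (hω : oscillation κ ℬ f t ≠ ⊤) {A : ℝ} (hA : 0 ≤ A)
    (hk : ∀ β ∈ ℬ, ∀ y, (1 + ‖y‖) ^ (n + 2) * ‖k β y‖ ≤ A) (hk0 : ∀ β ∈ ℬ, ∫ y, k β y = 0)
    (x : EuclideanSpace ℝ (Fin n)) :
    ‖piece κ ℬ k f t x‖ ≤
      A * (growthConst κ * (∫ y, weight n y) * (oscillation κ ℬ f t).toReal) := by
  have h1 : piece κ ℬ k f t x = ∫ y, ∑ β ∈ ℬ, k β y * (f β (x - dilation κ t y) - f β x) := by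
    have hi : ∀ β ∈ ℬ, Integrable fun y => k β y * f β (x - dilation κ t y) := fun β hβ =>
      ((hf β hβ).2.comp_sub_dilation t x).integrable_mul
        ((hf β hβ).1.comp (by fun_prop)) (k β)
    rw [piece, integral_finsetSum]
    · refine Finset.sum_congr rfl fun β hβ => ?_
      simp_rw [mul_sub]
      rw [integral_sub (hi β hβ) ((k β).integrable.mul_const _), integral_mul_const, hk0 β hβ,
        zero_mul, sub_zero]
    · intro β hβ
      simp_rw [mul_sub]
      exact (hi β hβ).sub ((k β).integrable.mul_const _)
  rw [h1]
  refine (norm_integral_le_of_norm_le (g := fun y => A * (growthConst κ * weight n y *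
    (oscillation κ ℬ f t).toReal)) (((integrable_weight.const_mul _).mul_const _).const_mul _)
    (Eventually.of_forall fun y => ?_)).trans_eq ?_
  · refine (norm_sum_le _ _).trans ?_
    have hkw : ∀ β ∈ ℬ, ‖k β y‖ ≤ A * ((1 + ‖y‖) ^ (n + 2))⁻¹ := fun β hβ => by
      rw [← div_eq_mul_inv, le_div_iff₀ (by positivity), mul_comm]
      exact hk β hβ y
    calc ∑ β ∈ ℬ, ‖k β y * (f β (x - dilation κ t y) - f β x)‖
        ≤ ∑ β ∈ ℬ, A * ((1 + ‖y‖) ^ (n + 2))⁻¹ * ‖f β (x - dilation κ t y) - f β x‖ :=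
          Finset.sum_le_sum fun β hβ => by
            rw [norm_mul]
            exact mul_le_mul_of_nonneg_right (hkw β hβ) (norm_nonneg _)
      _ ≤ A * ((1 + ‖y‖) ^ (n + 2))⁻¹ *
          (growthConst κ * (1 + ‖y‖) * (oscillation κ ℬ f t).toReal) := by
          rw [← Finset.mul_sum]
          gcongr
          exact sum_norm_sub_dilation_le hκ ht hω x y
      _ = _ := by
          rw [weight, show n + 2 = (n + 1) + 1 by ring, pow_succ]
          field_simp
  · rw [integral_const_mul, integral_mul_const, integral_const_mul]

/-- Mean value inequality along the segment. Its points lie within `n` of `y`, so the weights at `y`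
and at these points differ by at most a factor `n + 1`. -/
lemma norm_sub_translate_le (k : 𝓢(EuclideanSpace ℝ (Fin n), ℂ)) {B : ℝ} {L : ℕ}
    (hk : ∀ y, (1 + ‖y‖) ^ L * ‖fderiv ℝ k y‖ ≤ B) {η : EuclideanSpace ℝ (Fin n)} (hη : ‖η‖ ≤ n)
    (y : EuclideanSpace ℝ (Fin n)) :
    (1 + ‖y‖) ^ L * ‖k (y + η) - k y‖ ≤ B * (n + 1) ^ L * ‖η‖ := by
  have hb : ∀ z ∈ segment ℝ y (y + η),
      ‖fderiv ℝ k z‖ ≤ B * (n + 1) ^ L * ((1 + ‖y‖) ^ L)⁻¹ := fun z hz => by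
    have h1 : ‖y - z‖ ≤ n := by
      obtain ⟨s, hs, rfl⟩ := (segment_eq_image' ℝ y (y + η)) ▸ hz
      rw [add_sub_cancel_left, sub_add_cancel_left, norm_neg, norm_smul, Real.norm_of_nonneg hs.1]
      exact (mul_le_of_le_one_left (norm_nonneg _) hs.2).trans hη
    have h2 : 1 + ‖y‖ ≤ (n + 1) * (1 + ‖z‖) := by
      have := norm_le_insert' y z
      have hn : (0 : ℝ) ≤ n := Nat.cast_nonneg n
      nlinarith [norm_nonneg z]
    rw [← div_eq_mul_inv, le_div_iff₀ (by positivity)]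
    calc ‖fderiv ℝ k z‖ * (1 + ‖y‖) ^ L ≤ ‖fderiv ℝ k z‖ * ((n + 1) * (1 + ‖z‖)) ^ L := by gcongr
      _ = (1 + ‖z‖) ^ L * ‖fderiv ℝ k z‖ * (n + 1) ^ L := by rw [mul_pow]; ring
      _ ≤ _ := by gcongr; exact hk z
  have := (convex_segment y (y + η)).norm_image_sub_le_of_norm_fderiv_le
    (fun z _ => k.differentiableAt) hb (left_mem_segment ℝ _ _) (right_mem_segment ℝ _ _)
  rw [add_sub_cancel_left] at this
  calc _ ≤ (1 + ‖y‖) ^ L * (B * (n + 1) ^ L * ((1 + ‖y‖) ^ L)⁻¹ * ‖η‖) := by gcongr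
    _ = _ := by field_simp

/-- The constant in the increment estimate of the dyadic pieces. -/
def pieceConst (κ : Fin n → ℕ) (B : ℝ) : ℝ :=
  2 * (B * (n + 1) ^ (n + 3) * (growthConst κ * ∫ y, weight n y))

lemma pieceConst_nonneg {B : ℝ} (hB : 0 ≤ B) : 0 ≤ pieceConst κ B := by
  have h1 : 0 ≤ ∫ y, weight n y := integral_nonneg weight_nonneg
  have h2 := growthConst_nonneg (κ := κ)
  unfold pieceConst
  positivity

/-- If `|x-x'|_κ ≥ t`, the size bound at each point suffices. Otherwise the shift is moved onto the
kernel: `k(· + η) - k` again has mean zero, and its size is proportional to `‖η‖ ≤ n |x-x'|_κ / t`.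
-/
lemma norm_piece_sub_piece_le (hκ : ∀ l, 0 < κ l)
    {k : (Fin n → ℕ) → 𝓢(EuclideanSpace ℝ (Fin n), ℂ)}
    (hf : ∀ β ∈ ℬ, Continuous (f β) ∧ PolynomialGrowth (f β)) {t : ℝ} (ht : 0 < t)
    (hω : oscillation κ ℬ f t ≠ ⊤) {B : ℝ} (hB : 0 ≤ B)
    (hk : ∀ β ∈ ℬ, ∀ y, (1 + ‖y‖) ^ (n + 2) * ‖k β y‖ ≤ B ∧
      (1 + ‖y‖) ^ (n + 2) * ‖fderiv ℝ (k β) y‖ ≤ B)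
    (hk0 : ∀ β ∈ ℬ, ∫ y, k β y = 0) (x x' : EuclideanSpace ℝ (Fin n)) :
    ‖piece κ ℬ k f t x - piece κ ℬ k f t x'‖ ≤
      pieceConst κ B * (min 1 (quasiNorm κ (x - x') / t) * (oscillation κ ℬ f t).toReal) := by
  set I := growthConst κ * (∫ y, weight n y) * (oscillation κ ℬ f t).toReal with hI
  have hI0 : 0 ≤ I := mul_nonneg (mul_nonneg growthConst_nonneg (integral_nonneg weight_nonneg))
    ENNReal.toReal_nonneg
  have hn : (0 : ℝ) ≤ n := Nat.cast_nonneg n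
  have hn1 : (1 : ℝ) ≤ (n + 1) ^ (n + 3) := one_le_pow₀ (by linarith)
  have hconst : pieceConst κ B * (min 1 (quasiNorm κ (x - x') / t) *
      (oscillation κ ℬ f t).toReal) =
      2 * (B * (n + 1) ^ (n + 3)) * min 1 (quasiNorm κ (x - x') / t) * I := by
    rw [pieceConst, hI]; ring
  rw [hconst]
  rcases le_or_gt 1 (quasiNorm κ (x - x') / t) with hq | hq
  · rw [min_eq_left hq, mul_one]
    have h := fun z => norm_piece_le hκ hf ht hω hB (fun β hβ y => (hk β hβ y).1) hk0 z
    have hBI : 0 ≤ B * I := mul_nonneg hB hI0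
    calc _ ≤ B * I + B * I := (norm_sub_le _ _).trans (add_le_add (h x) (h x'))
      _ = 2 * (1 * (B * I)) := by ring
      _ ≤ 2 * ((n + 1) ^ (n + 3) * (B * I)) := by gcongr
      _ = _ := by ring
  · rw [min_eq_right hq.le]
    set η := dilation κ t⁻¹ (x - x') with hη
    have hηq : quasiNorm κ η = quasiNorm κ (x - x') / t := by
      rw [hη, quasiNorm_dilation hκ (inv_nonneg.2 ht.le), div_eq_inv_mul]
    have hηn : ‖η‖ ≤ n * (quasiNorm κ (x - x') / t) := by
      rw [← hηq]
      exact norm_le_of_quasiNorm_le_one hκ (hηq ▸ hq.le)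
    have hηn' : ‖η‖ ≤ n := hηn.trans (mul_le_of_le_one_right hn hq.le)
    have hxη : x = x' + dilation κ t η := by
      rw [hη, dilation_dilation, mul_inv_cancel₀ ht.ne', dilation_one]; abel
    let d : (Fin n → ℕ) → 𝓢(EuclideanSpace ℝ (Fin n), ℂ) := fun β =>
      SchwartzMap.compSubConstCLM ℂ (-η) (k β) - k β
    have hd : ∀ β y, d β y = k β (y + η) - k β y := fun β y => by
      simp [d, SchwartzMap.compSubConstCLM_apply]
    have hpiece : piece κ ℬ k f t x - piece κ ℬ k f t x' = piece κ ℬ d f t x' := by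
      simp only [piece]
      rw [← Finset.sum_sub_distrib]
      refine Finset.sum_congr rfl fun β hβ => ?_
      have hcg : ∀ k : 𝓢(EuclideanSpace ℝ (Fin n), ℂ),
          Integrable fun y => k y * f β (x' - dilation κ t y) :=
        ((hf β hβ).2.comp_sub_dilation t x').integrable_mul ((hf β hβ).1.comp (by fun_prop))
      have h1 : ∫ y, k β y * f β (x - dilation κ t y) =
          ∫ y, SchwartzMap.compSubConstCLM ℂ (-η) (k β) y * f β (x' - dilation κ t y) := by
        rw [← integral_add_right_eq_self _ η]
        refine integral_congr_ae (Eventually.of_forall fun y => ?_)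
        simp only [SchwartzMap.compSubConstCLM_apply, sub_neg_eq_add]
        congr 2
        rw [hxη, map_add]
        abel
      rw [h1, ← integral_sub (hcg _) (hcg _)]
      refine integral_congr_ae (Eventually.of_forall fun y => ?_)
      simp only [d, sub_apply]
      ring
    rw [hpiece]
    have hq0 : 0 ≤ quasiNorm κ (x - x') / t := div_nonneg (quasiNorm_nonneg _) ht.le
    refine (norm_piece_le hκ hf ht hω (A := B * (n + 1) ^ (n + 2) * ‖η‖) (by positivity)
      (fun β hβ y => ?_) (fun β hβ => ?_) x').trans ?_
    · rw [hd]
      exact norm_sub_translate_le (k β) (fun y => (hk β hβ y).2) hηn' y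
    · simp_rw [hd]
      rw [integral_sub ((k β).integrable.comp_add_right η) (k β).integrable,
        integral_add_right_eq_self (fun y => k β y), sub_self]
    · refine mul_le_mul_of_nonneg_right ?_ hI0
      calc B * (n + 1) ^ (n + 2) * ‖η‖
          ≤ B * (n + 1) ^ (n + 2) * ((n + 1) * (quasiNorm κ (x - x') / t)) := by
            gcongr
            refine hηn.trans (mul_le_mul_of_nonneg_right (by linarith) hq0)
        _ = 1 * (B * (n + 1) ^ (n + 3)) * (quasiNorm κ (x - x') / t) := by ring
        _ ≤ _ := by gcongr; exact one_le_two

end piece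

/-! ### Dyadic pieces tested against Fourier transforms. -/

section fourierPairing

variable {n : ℕ} {κ : Fin n → ℕ}

/-- The Schwartz function `χ(ξ) k̂(δ_t ξ)`. -/
def dilatedMultiplier (κ : Fin n → ℕ) (k : 𝓢(EuclideanSpace ℝ (Fin n), ℂ)) (t : ℝ) :
    𝓢(EuclideanSpace ℝ (Fin n), ℂ) →L[ℂ] 𝓢(EuclideanSpace ℝ (Fin n), ℂ) :=
  SchwartzMap.smulLeftCLM ℂ fun ξ => (𝓕 k) (dilation κ t ξ)

lemma dilatedMultiplier_apply (k χ : 𝓢(EuclideanSpace ℝ (Fin n), ℂ)) (t : ℝ)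
    (ξ : EuclideanSpace ℝ (Fin n)) :
    dilatedMultiplier κ k t χ ξ = (𝓕 k) (dilation κ t ξ) * χ ξ :=
  SchwartzMap.smulLeftCLM_apply_apply
    ((SchwartzMap.hasTemperateGrowth _).comp (dilation κ t).hasTemperateGrowth) _ _

/-- Self-adjointness of the Fourier transform for the bilinear form `⟨y, δ_t ξ⟩`, with the character
of `z` absorbed into `χ`. There is no change of variables by `δ_t`, hence no Jacobian. -/
lemma integral_mul_fourier_add_dilation (k χ : 𝓢(EuclideanSpace ℝ (Fin n), ℂ)) (t : ℝ)
    (z : EuclideanSpace ℝ (Fin n)) :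
    ∫ y, k y * (𝓕 χ) (z + dilation κ t y) = (𝓕 (dilatedMultiplier κ k t χ)) z := by
  let L : EuclideanSpace ℝ (Fin n) →ₗ[ℝ] EuclideanSpace ℝ (Fin n) →ₗ[ℝ] ℝ :=
    (innerₗ (EuclideanSpace ℝ (Fin n))).compl₂ (dilation κ t).toLinearMap
  have hLy : ∀ y ξ : EuclideanSpace ℝ (Fin n), L y ξ = inner ℝ y (dilation κ t ξ) := fun _ _ => rfl
  let g : EuclideanSpace ℝ (Fin n) → ℂ := fun ξ => Real.fourierChar (-inner ℝ ξ z) • χ ξ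
  have hg : Integrable g := by
    refine (χ.integrable (μ := volume)).mono ?_ (Eventually.of_forall fun ξ => ?_)
    · refine Continuous.aestronglyMeasurable ?_
      have h : Continuous fun ξ : EuclideanSpace ℝ (Fin n) => Real.fourierChar (-inner ℝ ξ z) :=
        Real.continuous_fourierChar.comp (by fun_prop)
      exact (continuous_subtype_val.comp h).smul χ.continuous
    · rw [Circle.norm_smul]
  have hLc : Continuous fun p : EuclideanSpace ℝ (Fin n) × EuclideanSpace ℝ (Fin n) => L p.1 p.2 := by
    simp only [hLy]; fun_prop
  have key := VectorFourier.integral_bilin_fourierIntegral_eq_flip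
    (ContinuousLinearMap.mul ℂ ℂ) (L := L) Real.continuous_fourierChar hLc
    (k.integrable (μ := volume)) hg
  simp only [VectorFourier.fourierIntegral, ContinuousLinearMap.mul_apply', LinearMap.flip_apply,
    hLy] at key
  have h1 : ∀ ξ, (∫ v, Real.fourierChar (-inner ℝ v (dilation κ t ξ)) • k v) =
      (𝓕 k) (dilation κ t ξ) := fun ξ => by
    rw [SchwartzMap.fourier_coe, Real.fourier_eq]
  have h2 : ∀ y, (∫ ξ, Real.fourierChar (-inner ℝ y (dilation κ t ξ)) • g ξ) =
      (𝓕 χ) (z + dilation κ t y) := fun y => by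
    rw [SchwartzMap.fourier_coe, Real.fourier_eq]
    refine integral_congr_ae (Eventually.of_forall fun ξ => ?_)
    simp only [g]
    rw [smul_smul, ← AddChar.map_add_eq_mul, inner_add_right, real_inner_comm,
      inner_dilation_left, add_comm, neg_add]
  simp_rw [h2] at key
  have h3 : ∀ ξ, (∫ v, Real.fourierChar (-inner ℝ v (dilation κ t ξ)) • k v) * g ξ =
      (𝓕 k) (dilation κ t ξ) * g ξ := fun ξ => by rw [h1]
  rw [integral_congr_ae (Eventually.of_forall h3)] at key
  rw [← key, SchwartzMap.fourier_coe (dilatedMultiplier κ k t χ), Real.fourier_eq]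
  refine integral_congr_ae (Eventually.of_forall fun ξ => ?_)
  simp only [g, dilatedMultiplier_apply, Circle.smul_def, smul_eq_mul]
  ring

/-- A Peetre-type inequality: decay at `z + δ_t y` becomes decay at `z` at the price of powers of `1
+ ‖y‖`. -/
lemma norm_pow_decay_add_dilation {h : EuclideanSpace ℝ (Fin n) → ℂ} {C : ℝ} {N : ℕ}
    (hh : ∀ y, ‖h y‖ * (1 + ‖y‖) ^ N ≤ C * weight n y) (t : ℝ)
    (z y : EuclideanSpace ℝ (Fin n)) :
    ‖h (z + dilation κ t y)‖ * (1 + ‖z‖) ^ N ≤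
      C * weight n z * ((1 + ‖dilation κ t‖) * (1 + ‖y‖)) ^ (N + (n + 1)) := by
  have h1 := one_add_norm_sub_dilation_le (κ := κ) t (z + dilation κ t y) y
  rw [add_sub_cancel_right] at h1
  have h2 := hh (z + dilation κ t y)
  rw [weight, ← div_eq_mul_inv, le_div_iff₀ (by positivity), mul_assoc, ← pow_add] at h2
  rw [weight, mul_right_comm, ← div_eq_mul_inv, le_div_iff₀ (by positivity), mul_assoc, ← pow_add]
  calc _ ≤ ‖h (z + dilation κ t y)‖ * ((1 + ‖z + dilation κ t y‖) *
        ((1 + ‖dilation κ t‖) * (1 + ‖y‖))) ^ (N + (n + 1)) := by gcongr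
    _ = ‖h (z + dilation κ t y)‖ * (1 + ‖z + dilation κ t y‖) ^ (N + (n + 1)) *
        ((1 + ‖dilation κ t‖) * (1 + ‖y‖)) ^ (N + (n + 1)) := by rw [mul_pow]; ring
    _ ≤ _ := by gcongr

/-- Fubini, the translation `x = z + δ_t y`, and Fubini again move the convolution from `f` to the
test function. The two swaps need integrability on the product before and after the translation. -/
lemma integral_piece_mul_fourier (k χ : 𝓢(EuclideanSpace ℝ (Fin n), ℂ))
    {f : EuclideanSpace ℝ (Fin n) → ℂ} (hc : Continuous f) (hf : PolynomialGrowth f) (t : ℝ) :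
    Integrable (fun x => (∫ y, k y * f (x - dilation κ t y)) * (𝓕 χ) x) ∧
    ∫ x, (∫ y, k y * f (x - dilation κ t y)) * (𝓕 χ) x =
      ∫ z, (𝓕 (dilatedMultiplier κ k t χ)) z * f z := by
  obtain ⟨K, N, hK⟩ := id hf
  set D := 1 + ‖dilation κ t‖ with hD
  obtain ⟨C₁, hC₁⟩ := exists_norm_mul_pow_le_weight (𝓕 χ) N
  obtain ⟨C₂, hC₂⟩ := exists_norm_mul_pow_le_weight k (N + (n + 1))
  obtain ⟨C₃, hC₃⟩ := exists_norm_mul_pow_le_weight k N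
  have hK' : ∀ x, ‖f x‖ ≤ |K| * (1 + ‖x‖) ^ N := fun x =>
    (hK x).trans (by gcongr; exact le_abs_self K)
  have hC₁' : ∀ y, ‖(𝓕 χ) y‖ * (1 + ‖y‖) ^ N ≤ |C₁| * weight n y := fun y =>
    (hC₁ y).trans (mul_le_mul_of_nonneg_right (le_abs_self _) (weight_nonneg y))
  have hI1 : Integrable (fun p : EuclideanSpace ℝ (Fin n) × EuclideanSpace ℝ (Fin n) =>
      k p.2 * f (p.1 - dilation κ t p.2) * (𝓕 χ) p.1) (volume.prod volume) := by
    refine ((integrable_weight.const_mul (|K| * D ^ N * |C₁|)).mul_prod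
      (integrable_weight.const_mul C₃)).mono' (by
        refine Continuous.aestronglyMeasurable ?_
        fun_prop) (Eventually.of_forall fun p => ?_)
    obtain ⟨x, y⟩ := p
    rw [norm_mul, norm_mul]
    calc ‖k y‖ * ‖f (x - dilation κ t y)‖ * ‖(𝓕 χ) x‖
        ≤ ‖k y‖ * (|K| * ((1 + ‖x‖) * (D * (1 + ‖y‖))) ^ N) * ‖(𝓕 χ) x‖ := by
          gcongr
          refine (hK' _).trans ?_
          gcongr
          exact one_add_norm_sub_dilation_le t x y
      _ = |K| * D ^ N * (‖(𝓕 χ) x‖ * (1 + ‖x‖) ^ N) * (‖k y‖ * (1 + ‖y‖) ^ N) := by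
          rw [mul_pow, mul_pow]; ring
      _ ≤ |K| * D ^ N * (|C₁| * weight n x) * (C₃ * weight n y) := by
          refine mul_le_mul (mul_le_mul_of_nonneg_left (hC₁' x) (by positivity)) (hC₃ y)
            (by positivity) ?_
          exact mul_nonneg (by positivity) (mul_nonneg (abs_nonneg _) (weight_nonneg x))
      _ = _ := by ring
  have hI2 : Integrable (fun p : EuclideanSpace ℝ (Fin n) × EuclideanSpace ℝ (Fin n) =>
      k p.1 * (f p.2 * (𝓕 χ) (p.2 + dilation κ t p.1))) (volume.prod volume) := by
    refine ((integrable_weight.const_mul C₂).mul_prod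
      (integrable_weight.const_mul (|K| * (|C₁| * D ^ (N + (n + 1)))))).mono' (by
        refine Continuous.aestronglyMeasurable ?_
        fun_prop) (Eventually.of_forall fun p => ?_)
    obtain ⟨y, z⟩ := p
    rw [norm_mul, norm_mul]
    calc ‖k y‖ * (‖f z‖ * ‖(𝓕 χ) (z + dilation κ t y)‖)
        ≤ ‖k y‖ * (|K| * (1 + ‖z‖) ^ N * ‖(𝓕 χ) (z + dilation κ t y)‖) := by
          gcongr; exact hK' z
      _ = ‖k y‖ * (|K| * (‖(𝓕 χ) (z + dilation κ t y)‖ * (1 + ‖z‖) ^ N)) := by ring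
      _ ≤ ‖k y‖ * (|K| * (|C₁| * weight n z * (D * (1 + ‖y‖)) ^ (N + (n + 1)))) := by
          refine mul_le_mul_of_nonneg_left (mul_le_mul_of_nonneg_left ?_ (abs_nonneg _))
            (norm_nonneg _)
          exact norm_pow_decay_add_dilation hC₁' t z y
      _ = ‖k y‖ * (1 + ‖y‖) ^ (N + (n + 1)) *
            (|K| * (|C₁| * D ^ (N + (n + 1))) * weight n z) := by
          rw [mul_pow]; ring
      _ ≤ _ := by
          refine mul_le_mul_of_nonneg_right (hC₂ y) (mul_nonneg (by positivity) (weight_nonneg z))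
  have hI1' := hI1.integral_prod_left
  simp only [integral_mul_const] at hI1'
  refine ⟨hI1', ?_⟩
  calc ∫ x, (∫ y, k y * f (x - dilation κ t y)) * (𝓕 χ) x
      = ∫ x, ∫ y, k y * f (x - dilation κ t y) * (𝓕 χ) x := by simp only [integral_mul_const]
    _ = ∫ y, ∫ x, k y * f (x - dilation κ t y) * (𝓕 χ) x := integral_integral_swap hI1
    _ = ∫ y, ∫ z, k y * (f z * (𝓕 χ) (z + dilation κ t y)) := by
        refine integral_congr_ae (Eventually.of_forall fun y => ?_)
        simp only
        rw [← integral_add_right_eq_self _ (dilation κ t y)]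
        simp only [add_sub_cancel_right, mul_assoc]
    _ = ∫ z, ∫ y, k y * (f z * (𝓕 χ) (z + dilation κ t y)) := integral_integral_swap hI2
    _ = ∫ z, (𝓕 (dilatedMultiplier κ k t χ)) z * f z := by
        refine integral_congr_ae (Eventually.of_forall fun z => ?_)
        simp only [← integral_mul_fourier_add_dilation, ← integral_mul_const]
        exact integral_congr_ae (Eventually.of_forall fun y => by simp only; ring)

end fourierPairing

/-! ### The equation in frequency space. -/

section distribution

variable {n : ℕ} {κ : Fin n → ℕ} {m : ℕ}

lemma imagMonomial_two_pi (γ : Fin n → ℕ) (ξ : EuclideanSpace ℝ (Fin n)) :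
    imagMonomial γ ((2 * Real.pi) • ξ) = ∏ l, (2 * Real.pi * Complex.I * (ξ l : ℂ)) ^ γ l := by
  refine Finset.prod_congr rfl fun l _ => ?_
  rw [PiLp.smul_apply, smul_eq_mul]
  push_cast
  ring

lemma hasTemperateGrowth_coord_pow (l : Fin n) (i : ℕ) :
    (fun ξ : EuclideanSpace ℝ (Fin n) =>
      (2 * Real.pi * Complex.I * (ξ l : ℂ)) ^ i).HasTemperateGrowth := by
  have h := hasTemperateGrowth_coord l
  exact Function.HasTemperateGrowth.pow (by fun_prop) i

lemma hasTemperateGrowth_listProd (γ : Fin n → ℕ) (s : List (Fin n)) :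
    (fun ξ : EuclideanSpace ℝ (Fin n) =>
      (s.map fun l => (2 * Real.pi * Complex.I * (ξ l : ℂ)) ^ γ l).prod).HasTemperateGrowth := by
  induction s with
  | nil => simp only [List.map_nil, List.prod_nil]; fun_prop
  | cons l s ih =>
    simp only [List.map_cons, List.prod_cons]
    exact (hasTemperateGrowth_coord_pow l _).mul ih

lemma hasTemperateGrowth_imagMonomial (γ : Fin n → ℕ) :
    (fun ξ : EuclideanSpace ℝ (Fin n) =>
      imagMonomial γ ((2 * Real.pi) • ξ)).HasTemperateGrowth := by
  simp only [imagMonomial_two_pi, Fin.prod_univ_def]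
  exact hasTemperateGrowth_listProd γ _

lemma lineDerivOp_single_apply_fourier (w : 𝓢'(EuclideanSpace ℝ (Fin n), ℂ)) (l : Fin n)
    (χ : 𝓢(EuclideanSpace ℝ (Fin n), ℂ)) :
    (∂_{EuclideanSpace.single l (1 : ℝ)} w) (𝓕 χ) =
      w (𝓕 (SchwartzMap.smulLeftCLM ℂ (fun ξ => 2 * Real.pi * Complex.I * (ξ l : ℂ)) χ)) := by
  have h1 : (fun x : EuclideanSpace ℝ (Fin n) =>
      inner ℝ x (EuclideanSpace.single l (1 : ℝ))).HasTemperateGrowth := by fun_prop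
  have h2 := hasTemperateGrowth_coord l
  rw [TemperedDistribution.lineDerivOp_apply_apply, SchwartzMap.lineDerivOp_fourier_eq,
    neg_smul, FourierTransform.fourier_neg, neg_neg]
  congr 2
  ext x
  rw [smul_apply, SchwartzMap.smulLeftCLM_apply_apply h1,
    SchwartzMap.smulLeftCLM_apply_apply (by fun_prop)]
  simp [EuclideanSpace.inner_single_right, mul_assoc]

lemma iterate_lineDerivOp_single_apply_fourier (w : 𝓢'(EuclideanSpace ℝ (Fin n), ℂ)) (l : Fin n)
    (i : ℕ) (χ : 𝓢(EuclideanSpace ℝ (Fin n), ℂ)) :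
    ((fun w : 𝓢'(EuclideanSpace ℝ (Fin n), ℂ) =>
      ∂_{EuclideanSpace.single l (1 : ℝ)} w)^[i] w) (𝓕 χ) =
      w (𝓕 (SchwartzMap.smulLeftCLM ℂ
        (fun ξ => (2 * Real.pi * Complex.I * (ξ l : ℂ)) ^ i) χ)) := by
  have h2 := hasTemperateGrowth_coord l
  induction i generalizing χ with
  | zero => simp
  | succ i ih =>
    rw [Function.iterate_succ_apply', lineDerivOp_single_apply_fourier, ih,
      SchwartzMap.smulLeftCLM_smulLeftCLM_apply (hasTemperateGrowth_coord_pow l i)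
        (by fun_prop)]
    simp only [pow_succ]
    rfl

/-- The derivative `D^γ` of a distribution, tested against a Fourier transform. -/
lemma multiDeriv_apply_fourier (γ : Fin n → ℕ) (w : 𝓢'(EuclideanSpace ℝ (Fin n), ℂ))
    (χ : 𝓢(EuclideanSpace ℝ (Fin n), ℂ)) :
    multiDeriv γ w (𝓕 χ) = w (𝓕 (SchwartzMap.smulLeftCLM ℂ
      (fun ξ => imagMonomial γ ((2 * Real.pi) • ξ)) χ)) := by
  simp only [imagMonomial_two_pi, Fin.prod_univ_def, multiDeriv]
  generalize List.finRange n = s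
  induction s generalizing χ with
  | nil => simp
  | cons l s ih =>
    rw [List.foldr_cons, iterate_lineDerivOp_single_apply_fourier, ih,
      SchwartzMap.smulLeftCLM_smulLeftCLM_apply (hasTemperateGrowth_listProd γ s)
        (hasTemperateGrowth_coord_pow l _)]
    simp only [List.map_cons, List.prod_cons, mul_comm ((2 * Real.pi * Complex.I * _ : ℂ) ^ γ l)]
    rfl

lemma hasTemperateGrowth_annulus (t : ℝ) :
    (fun ξ => annulus κ (dilation κ t ξ)).HasTemperateGrowth := by
  simp only [annulus, dilation_dilation]
  exact (hasTemperateGrowth_cutoff_dilation _).sub (hasTemperateGrowth_cutoff_dilation _)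

lemma hasTemperateGrowth_cutReciprocal (hκ : ∀ l, 0 < κ l) {r : ℝ} (hr : 0 < r)
    {p : EuclideanSpace ℝ (Fin n) → ℂ} (hp : ContDiff ℝ ∞ p) (t : ℝ) :
    (fun ξ => cutReciprocal κ r p (dilation κ t ξ)).HasTemperateGrowth := by
  have h1 : HasCompactSupport (cutReciprocal κ r p) :=
    HasCompactSupport.of_support_subset_isCompact (isCompact_closedBall 0 2) fun ξ hξ => by
      by_contra h
      refine hξ ?_
      rw [cutReciprocal, annulus_of_le_norm hκ (le_of_lt (by simpa using h)), zero_mul]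
  have h2 : ContDiff ℝ ∞ (cutReciprocal κ r p) :=
    contDiff_annulus.mul ((contDiff_smoothInv hr).comp (hp.comp (contDiff_id.const_smul _)))
  exact (h1.hasTemperateGrowth h2).comp (dilation κ t).hasTemperateGrowth

/-- The equation `P u = ∑ D^β f_β`, tested on a dyadic frequency annulus. -/
lemma sum_apply_dilatedMultiplier (hκ : ∀ l, 0 < κ l) {𝒜 ℬ : Finset (Fin n → ℕ)} {lam : ℝ}
    (hlam : 0 < lam) {a : (Fin n → ℕ) → (Fin n → ℕ) → ℂ} (hsm : ContDiff ℝ ∞ (symbol 𝒜 ℬ a))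
    (hp : ∀ ξ, lam * quasiNorm κ ξ ^ m ≤ ‖symbol 𝒜 ℬ a ξ‖)
    (hom : ∀ (t : ℝ) ξ, symbol 𝒜 ℬ a (dilation κ t ξ) = (t : ℂ) ^ m * symbol 𝒜 ℬ a ξ)
    {u : 𝓢'(EuclideanSpace ℝ (Fin n), ℂ)}
    {F : (Fin n → ℕ) → 𝓢'(EuclideanSpace ℝ (Fin n), ℂ)}
    (hu : constCoeffOp 𝒜 ℬ a u = ∑ β ∈ ℬ, multiDeriv β (F β))
    {α : Fin n → ℕ} (hα : ∀ β ∈ ℬ, weightedOrder κ (α + β) = m)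
    {k : (Fin n → ℕ) → 𝓢(EuclideanSpace ℝ (Fin n), ℂ)}
    (hk : ∀ β ∈ ℬ, ∀ ξ, (𝓕 (k β)) ξ = imagMonomial (α + β) ((2 * Real.pi) • ξ) *
      cutReciprocal κ (symbolLowerBound n m lam) (symbol 𝒜 ℬ a) ξ)
    (t : ℝ) (χ : 𝓢(EuclideanSpace ℝ (Fin n), ℂ)) :
    ∑ β ∈ ℬ, F β (𝓕 (dilatedMultiplier κ (k β) t χ)) =
      multiDeriv α u (𝓕 (SchwartzMap.smulLeftCLM ℂ
        (fun ξ => annulus κ (dilation κ t ξ)) χ)) := by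
  have hr := symbolLowerBound_pos (n := n) (m := m) hlam
  have hcut := hasTemperateGrowth_cutReciprocal hκ hr hsm t
  have hmon := fun γ : Fin n → ℕ => hasTemperateGrowth_imagMonomial γ
  -- Testing the equation with `𝓕 Θ` yields both sides: on the right, monomials times the cut-off
  -- reciprocal are the kernels' transforms; on the left, the symbol times that reciprocal collapses
  -- to the annulus.
  set Θ : 𝓢(EuclideanSpace ℝ (Fin n), ℂ) := SchwartzMap.smulLeftCLM ℂ
    (fun ξ => imagMonomial α ((2 * Real.pi) • ξ)) (((t : ℂ) ^ m) • SchwartzMap.smulLeftCLM ℂ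
      (fun ξ => cutReciprocal κ (symbolLowerBound n m lam) (symbol 𝒜 ℬ a) (dilation κ t ξ)) χ)
    with hΘ
  have hΘx : ∀ ξ, Θ ξ = imagMonomial α ((2 * Real.pi) • ξ) * ((t : ℂ) ^ m *
      (cutReciprocal κ (symbolLowerBound n m lam) (symbol 𝒜 ℬ a) (dilation κ t ξ) * χ ξ)) :=
    fun ξ => by
      rw [hΘ, SchwartzMap.smulLeftCLM_apply_apply (hmon α), smul_apply,
        SchwartzMap.smulLeftCLM_apply_apply hcut]
      simp only [smul_eq_mul]
  have h1 : ∀ β ∈ ℬ, F β (𝓕 (dilatedMultiplier κ (k β) t χ)) = multiDeriv β (F β) (𝓕 Θ) :=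
    fun β hβ => by
      rw [multiDeriv_apply_fourier]
      congr 2
      ext ξ
      rw [dilatedMultiplier_apply, hk β hβ, SchwartzMap.smulLeftCLM_apply_apply (hmon β), hΘx,
        ← map_smul, imagMonomial_dilation, hα β hβ, imagMonomial_add]
      simp only [smul_eq_mul]
      ring
  have h2 : (∑ β ∈ ℬ, multiDeriv β (F β)) (𝓕 Θ) = ∑ β ∈ ℬ, multiDeriv β (F β) (𝓕 Θ) :=
    sum_apply _ _ _
  have h3 : constCoeffOp 𝒜 ℬ a u (𝓕 Θ) =
      ∑ α' ∈ 𝒜, ∑ β ∈ ℬ, a α' β * multiDeriv (α' + β) u (𝓕 Θ) := by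
    rw [constCoeffOp]
    simp only [sum_apply, smul_apply, smul_eq_mul]
  rw [Finset.sum_congr rfl h1, ← h2, ← hu, h3, multiDeriv_apply_fourier]
  simp only [multiDeriv_apply_fourier]
  have h4 : SchwartzMap.smulLeftCLM ℂ (fun ξ => imagMonomial α ((2 * Real.pi) • ξ))
      (SchwartzMap.smulLeftCLM ℂ (fun ξ => annulus κ (dilation κ t ξ)) χ) =
      ∑ α' ∈ 𝒜, ∑ β ∈ ℬ, a α' β • SchwartzMap.smulLeftCLM ℂ
        (fun ξ => imagMonomial (α' + β) ((2 * Real.pi) • ξ)) Θ := by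
    ext ξ
    rw [SchwartzMap.smulLeftCLM_apply_apply (hmon α),
      SchwartzMap.smulLeftCLM_apply_apply (hasTemperateGrowth_annulus t),
      ← mul_cutReciprocal_dilation hκ hlam hp hom]
    simp only [sum_apply, smul_apply, SchwartzMap.smulLeftCLM_apply_apply (hmon _), hΘx,
      smul_eq_mul]
    simp only [← mul_assoc, ← Finset.sum_mul]
    rw [show symbol 𝒜 ℬ a ((2 * Real.pi) • ξ) = ∑ α' ∈ 𝒜, ∑ β ∈ ℬ,
      a α' β * imagMonomial (α' + β) ((2 * Real.pi) • ξ) from rfl]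
    ring
  have h5 : ∀ ψ : 𝓢(EuclideanSpace ℝ (Fin n), ℂ),
      𝓕 ψ = FourierTransform.fourierCLM ℂ 𝓢(EuclideanSpace ℝ (Fin n), ℂ) ψ := fun _ => rfl
  rw [h4]
  simp only [h5, map_sum, map_smul, smul_eq_mul]

end distribution

/-! ### Renormalized sums of dyadic families. -/

section dyadicSum

variable {n : ℕ} {κ : Fin n → ℕ}

/-- Reduces distance `q` to distance one, so that finiteness of the Dini bound at radius one gives
convergence for all increments. -/
lemma min_one_div_le {q s : ℝ} (hq : 0 ≤ q) (hs : 0 < s) :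
    min 1 (q / s) ≤ (1 + q) * min 1 (1 / s) := by
  rcases le_total 1 (1 / s) with h | h
  · rw [min_eq_left h]
    exact (min_le_left _ _).trans (by linarith)
  · rw [min_eq_right h]
    refine (min_le_right _ _).trans ?_
    rw [mul_one_div]
    gcongr
    linarith

/-- A family of functions on `ℝⁿ`, indexed by the dyadic scales, with increments controlled by
summable weights. -/
structure IsDyadicFamily (κ : Fin n → ℕ) (h : ℤ → EuclideanSpace ℝ (Fin n) → ℂ) (w : ℤ → ℝ)
    (P : ℝ) : Prop where
  const_nonneg : 0 ≤ P
  weight_nonneg : ∀ j, 0 ≤ w j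
  summable : Summable fun j : ℤ => min 1 (1 / (2 : ℝ) ^ j) * w j
  norm_sub_le : ∀ j x y,
    ‖h j x - h j y‖ ≤ P * (min 1 (quasiNorm κ (x - y) / 2 ^ j) * w j)

namespace IsDyadicFamily

variable {h : ℤ → EuclideanSpace ℝ (Fin n) → ℂ} {w : ℤ → ℝ} {P : ℝ}

lemma norm_sub_le_mul (H : IsDyadicFamily κ h w P) (j : ℤ) (x y : EuclideanSpace ℝ (Fin n)) :
    ‖h j x - h j y‖ ≤ P * (1 + quasiNorm κ (x - y)) * (min 1 (1 / (2 : ℝ) ^ j) * w j) := by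
  refine (H.norm_sub_le j x y).trans ?_
  rw [mul_assoc, ← mul_assoc (1 + _)]
  have h1 := H.const_nonneg
  have h2 := H.weight_nonneg j
  gcongr
  exact min_one_div_le (quasiNorm_nonneg _) (by positivity)

lemma summable_norm_sub (H : IsDyadicFamily κ h w P) (x y : EuclideanSpace ℝ (Fin n)) :
    Summable fun j => ‖h j x - h j y‖ :=
  Summable.of_nonneg_of_le (fun _ => norm_nonneg _) (fun j => H.norm_sub_le_mul j x y)
    (H.summable.mul_left _)

lemma tendsto_sub (hκ : ∀ l, 0 < κ l) (H : IsDyadicFamily κ h w P) (j : ℤ)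
    (x₀ : EuclideanSpace ℝ (Fin n)) : Tendsto (fun x => h j x - h j x₀) (𝓝 x₀) (𝓝 0) := by
  have hlim : Tendsto (fun x => P * (quasiNorm κ (x - x₀) / 2 ^ j * w j)) (𝓝 x₀) (𝓝 0) := by
    have hc : Continuous fun x => P * (quasiNorm κ (x - x₀) / 2 ^ j * w j) := by
      have := continuous_quasiNorm (κ := κ)
      fun_prop
    simpa [quasiNorm_zero hκ] using hc.tendsto x₀
  refine squeeze_zero_norm (fun x => (H.norm_sub_le j x x₀).trans ?_) hlim
  have h1 := H.const_nonneg
  have h2 := H.weight_nonneg j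
  gcongr
  exact min_le_right _ _

lemma continuous (hκ : ∀ l, 0 < κ l) (H : IsDyadicFamily κ h w P) (j : ℤ) : Continuous (h j) :=
  continuous_iff_continuousAt.2 fun x₀ => tendsto_sub_nhds_zero_iff.1 (H.tendsto_sub hκ j x₀)

/-- The renormalized sum of a dyadic family. -/
def sum (h : ℤ → EuclideanSpace ℝ (Fin n) → ℂ) (x : EuclideanSpace ℝ (Fin n)) : ℂ :=
  ∑' j, (h j x - h j 0)

lemma sum_sub_sum (H : IsDyadicFamily κ h w P) (x y : EuclideanSpace ℝ (Fin n)) :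
    sum h x - sum h y = ∑' j, (h j x - h j y) := by
  rw [sum, sum, ← (H.summable_norm_sub x 0).of_norm.tsum_sub (H.summable_norm_sub y 0).of_norm]
  simp

lemma continuous_sum (hκ : ∀ l, 0 < κ l) (H : IsDyadicFamily κ h w P) : Continuous (sum h) := by
  refine continuous_iff_continuousAt.2 fun x₀ => tendsto_sub_nhds_zero_iff.1 ?_
  simp only [H.sum_sub_sum]
  rw [← tsum_zero (α := ℂ) (β := ℤ)]
  refine tendsto_tsum_of_dominated_convergence (H.summable.mul_left (P * (1 + 1)))
    (fun j => H.tendsto_sub hκ j x₀) ?_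
  have hq : Tendsto (fun x => quasiNorm κ (x - x₀)) (𝓝 x₀) (𝓝 0) := by
    have hc : Continuous fun x => quasiNorm κ (x - x₀) := by
      have := continuous_quasiNorm (κ := κ)
      fun_prop
    simpa [quasiNorm_zero hκ] using hc.tendsto x₀
  filter_upwards [hq.eventually_le_const zero_lt_one] with x hx j
  refine (H.norm_sub_le_mul j x x₀).trans ?_
  have h1 := H.const_nonneg
  have h2 := H.weight_nonneg j
  gcongr

lemma tsum_norm_sub_le (hκ : ∀ l, 0 < κ l) (H : IsDyadicFamily κ h w P)
    (x : EuclideanSpace ℝ (Fin n)) :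
    ∑' j, ‖h j x - h j 0‖ ≤
      P * (∑' j : ℤ, min 1 (1 / (2 : ℝ) ^ j) * w j) * (n + 2) * (1 + ‖x‖) := by
  have h0 : 0 ≤ ∑' j : ℤ, min 1 (1 / (2 : ℝ) ^ j) * w j :=
    tsum_nonneg fun j => mul_nonneg (by positivity) (H.weight_nonneg j)
  have h1 := H.const_nonneg
  calc ∑' j, ‖h j x - h j 0‖
      ≤ ∑' j : ℤ, P * (1 + quasiNorm κ (x - 0)) * (min 1 (1 / (2 : ℝ) ^ j) * w j) :=
        (H.summable_norm_sub x 0).tsum_le_tsum (fun j => H.norm_sub_le_mul j x 0)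
          (H.summable.mul_left _)
    _ = P * (∑' j : ℤ, min 1 (1 / (2 : ℝ) ^ j) * w j) * (1 + quasiNorm κ x) := by
        rw [tsum_mul_left, sub_zero]; ring
    _ ≤ P * (∑' j : ℤ, min 1 (1 / (2 : ℝ) ^ j) * w j) * ((n + 2) * (1 + ‖x‖)) := by
        gcongr
        have := quasiNorm_le_one_add_norm hκ x
        nlinarith [norm_nonneg x]
    _ = _ := by ring

lemma polynomialGrowth_sum (hκ : ∀ l, 0 < κ l) (H : IsDyadicFamily κ h w P) :
    PolynomialGrowth (sum h) :=
  ⟨_, 1, fun x => by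
    rw [pow_one]
    exact (norm_tsum_le_tsum_norm (H.summable_norm_sub x 0)).trans (H.tsum_norm_sub_le hκ x)⟩

lemma hasSum_integral (hκ : ∀ l, 0 < κ l) (H : IsDyadicFamily κ h w P)
    (φ : 𝓢(EuclideanSpace ℝ (Fin n), ℂ)) :
    HasSum (fun j => ∫ x, φ x * (h j x - h j 0)) (∫ x, φ x * sum h x) := by
  obtain ⟨C, hC⟩ := exists_norm_mul_pow_le_weight φ 1
  refine hasSum_integral_of_dominated_convergence (fun j x => ‖φ x‖ * ‖h j x - h j 0‖)
    (fun j => ?_) (fun j => Eventually.of_forall fun x => (norm_mul _ _).le)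
    (Eventually.of_forall fun x => (H.summable_norm_sub x 0).mul_left _) ?_
    (Eventually.of_forall fun x => ((H.summable_norm_sub x 0).of_norm.hasSum).mul_left _)
  · exact (φ.continuous.mul ((H.continuous hκ j).sub continuous_const)).aestronglyMeasurable
  · simp only [tsum_mul_left]
    -- Continuity serves only to make the dominating function measurable; its integrability comes
    -- from linear growth against Schwartz decay.
    have hc : Continuous fun x => ∑' j, ‖h j x - h j 0‖ := by
      refine continuous_iff_continuousAt.2 fun x₀ => ?_
      refine tendsto_tsum_of_dominated_convergence (bound := fun j : ℤ =>
        P * (1 + (quasiNorm κ (x₀ - 0) + 1)) * (min 1 (1 / (2 : ℝ) ^ j) * w j))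
        (H.summable.mul_left _)
        (fun j => ((H.continuous hκ j).sub continuous_const).norm.tendsto x₀) ?_
      have hc : Continuous fun x : EuclideanSpace ℝ (Fin n) => quasiNorm κ (x - 0) := by
        have := continuous_quasiNorm (κ := κ)
        fun_prop
      filter_upwards [(hc.tendsto x₀).eventually_le_const (lt_add_one _)] with x hx j
      rw [norm_norm]
      refine (H.norm_sub_le_mul j x 0).trans ?_
      have h1 := H.const_nonneg
      have h2 := H.weight_nonneg j
      gcongr
    set A := P * (∑' j : ℤ, min 1 (1 / (2 : ℝ) ^ j) * w j) * (n + 2) with hA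
    have hA0 : 0 ≤ A := by
      have h1 := H.const_nonneg
      have : 0 ≤ ∑' j : ℤ, min 1 (1 / (2 : ℝ) ^ j) * w j :=
        tsum_nonneg fun j => mul_nonneg (by positivity) (H.weight_nonneg j)
      positivity
    refine (integrable_weight.const_mul (A * C)).mono'
      (φ.continuous.norm.mul hc).aestronglyMeasurable (Eventually.of_forall fun x => ?_)
    rw [Real.norm_of_nonneg (mul_nonneg (norm_nonneg _) (tsum_nonneg fun _ => norm_nonneg _))]
    calc _ ≤ ‖φ x‖ * (A * (1 + ‖x‖)) := by gcongr; exact H.tsum_norm_sub_le hκ x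
      _ = A * (‖φ x‖ * (1 + ‖x‖) ^ 1) := by ring
      _ ≤ A * (C * weight n x) := mul_le_mul_of_nonneg_left (hC x) hA0
      _ = _ := by ring

end IsDyadicFamily

lemma oscillation_zpow_ne_top {osc : ℝ → ℝ≥0∞} (hosc : Monotone osc) (h : diniBound osc 1 ≠ ⊤)
    (j : ℤ) :
    osc (2 ^ j) ≠ ⊤ := by
  have h1 : ENNReal.ofReal (min 1 (1 / 2 ^ j)) * osc (2 ^ j) ≠ ⊤ :=
    ne_top_of_le_ne_top (ENNReal.mul_ne_top (by simp) h)
      ((ENNReal.le_tsum j).trans (diniBound_ge_dyadic hosc one_pos))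
  intro h2
  rw [h2, ENNReal.mul_top] at h1
  · exact h1 rfl
  · rw [ne_eq, ENNReal.ofReal_eq_zero, not_le]
    positivity

lemma summable_dyadic {osc : ℝ → ℝ≥0∞} (hosc : Monotone osc) (h : diniBound osc 1 ≠ ⊤) :
    Summable fun j : ℤ => min 1 (1 / (2 : ℝ) ^ j) * (osc (2 ^ j)).toReal := by
  have h1 : ∑' j : ℤ, ENNReal.ofReal (min 1 (1 / 2 ^ j)) * osc (2 ^ j) ≠ ⊤ :=
    ne_top_of_le_ne_top (ENNReal.mul_ne_top (by simp) h) (diniBound_ge_dyadic hosc one_pos)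
  refine (ENNReal.summable_toReal h1).congr fun j => ?_
  rw [ENNReal.toReal_mul, ENNReal.toReal_ofReal (by positivity)]

lemma enorm_sum_sub_sum_le (hκ : ∀ l, 0 < κ l) {h : ℤ → EuclideanSpace ℝ (Fin n) → ℂ}
    {osc : ℝ → ℝ≥0∞} {P : ℝ} (hosc : Monotone osc) (hfin : ∀ j : ℤ, osc (2 ^ j) ≠ ⊤)
    (H : IsDyadicFamily κ h (fun j => (osc (2 ^ j)).toReal) P) (x y : EuclideanSpace ℝ (Fin n)) :
    ‖IsDyadicFamily.sum h x - IsDyadicFamily.sum h y‖ₑ ≤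
      ENNReal.ofReal (P * 4) * diniBound osc (quasiNorm κ (x - y)) := by
  rcases (quasiNorm_nonneg (κ := κ) (x - y)).eq_or_lt with hq | hq
  · have : x = y := sub_eq_zero.1 (eq_zero_of_quasiNorm_eq_zero hκ hq.symm)
    simp [this]
  rw [H.sum_sub_sum]
  calc ‖∑' j, (h j x - h j y)‖ₑ ≤ ∑' j, ‖h j x - h j y‖ₑ := enorm_tsum_le_tsum_enorm
    _ ≤ ∑' j : ℤ, ENNReal.ofReal P *
          (ENNReal.ofReal (min 1 (quasiNorm κ (x - y) / 2 ^ j)) * osc (2 ^ j)) := by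
        refine ENNReal.tsum_le_tsum fun j => ?_
        rw [← ofReal_norm]
        refine (ENNReal.ofReal_le_ofReal (H.norm_sub_le j x y)).trans_eq ?_
        rw [ENNReal.ofReal_mul H.const_nonneg, ENNReal.ofReal_mul (by positivity),
          ENNReal.ofReal_toReal (hfin j)]
    _ ≤ ENNReal.ofReal P * (4 * diniBound osc (quasiNorm κ (x - y))) := by
        rw [ENNReal.tsum_mul_left]
        gcongr
        exact diniBound_ge_dyadic hosc hq
    _ = _ := by
        rw [ENNReal.ofReal_mul H.const_nonneg, mul_assoc]
        norm_num

end dyadicSum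

/-! ### Reconstruction of the distribution up to a polynomial. -/

variable {n : ℕ} {κ : Fin n → ℕ}

/-- A tempered distribution as a functional of the Fourier transform of the test function. -/
def fourierPullback (T : 𝓢'(EuclideanSpace ℝ (Fin n), ℂ)) :
    𝓢(EuclideanSpace ℝ (Fin n), ℂ) →L[ℂ] ℂ where
  toFun χ := T (𝓕 χ)
  map_add' χ₁ χ₂ := by rw [FourierTransform.fourier_add, map_add]
  map_smul' c χ := by rw [FourierTransform.fourier_smul, map_smul]; rfl
  cont := (map_continuous T).comp
    (FourierTransform.fourierCLM ℂ 𝓢(EuclideanSpace ℝ (Fin n), ℂ)).continuous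

lemma integral_fourier (χ : 𝓢(EuclideanSpace ℝ (Fin n), ℂ)) : ∫ x, (𝓕 χ) x = χ 0 := by
  rw [← fourierInv_apply_zero, FourierTransform.fourierInv_fourier_eq]

lemma integral_eq_fourier_zero (k : 𝓢(EuclideanSpace ℝ (Fin n), ℂ)) : ∫ y, k y = (𝓕 k) 0 := by
  rw [SchwartzMap.fourier_coe, Real.fourier_eq]
  simp

/-- If the dyadic pieces of `T` are the members of a dyadic family, then `T` is the sum of that
family up to a polynomial. -/
lemma exists_polynomial_of_isDyadicFamily (hκ : ∀ l, 0 < κ l)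
    {h : ℤ → EuclideanSpace ℝ (Fin n) → ℂ} {w : ℤ → ℝ} {P : ℝ} (H : IsDyadicFamily κ h w P)
    (T : 𝓢'(EuclideanSpace ℝ (Fin n), ℂ))
    (hT : ∀ (j : ℤ) (χ : 𝓢(EuclideanSpace ℝ (Fin n), ℂ)), Integrable (fun x => h j x * (𝓕 χ) x) ∧
      ∫ x, h j x * (𝓕 χ) x = T (𝓕 (SchwartzMap.smulLeftCLM ℂ
        (fun ξ => annulus κ (dilation κ (2 ^ j) ξ)) χ))) :
    ∃ Q : MvPolynomial (Fin n) ℂ, IsRepresentedBy T fun x =>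
      IsDyadicFamily.sum h x + MvPolynomial.eval (fun l => (x l : ℂ)) Q := by
  have hint : ∀ φ : 𝓢(EuclideanSpace ℝ (Fin n), ℂ),
      Integrable fun x => φ x * IsDyadicFamily.sum h x :=
    (H.polynomialGrowth_sum hκ).integrable_mul (H.continuous_sum hκ)
  let S : 𝓢(EuclideanSpace ℝ (Fin n), ℂ) →ₗ[ℂ] ℂ :=
    { toFun := fun χ => ∫ x, (𝓕 χ) x * IsDyadicFamily.sum h x
      map_add' := fun χ₁ χ₂ => by
        rw [FourierTransform.fourier_add, ← integral_add (hint _) (hint _)]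
        exact integral_congr_ae (Eventually.of_forall fun x => by
          simp only [add_apply, add_mul])
      map_smul' := fun c χ => by
        rw [FourierTransform.fourier_smul, RingHom.id_apply, smul_eq_mul, ← integral_const_mul]
        exact integral_congr_ae (Eventually.of_forall fun x => by
          simp only [smul_apply, smul_eq_mul, mul_assoc]) }
  obtain ⟨L, hL⟩ := exists_order_tendsto_bandPass hκ (fourierPullback T)
  -- Order `L + 1` forces `χ 0 = 0` even if `L = 0`. As `∫ 𝓕 χ = χ 0`, the renormalizing constants
  -- `h j 0` then drop out.
  obtain ⟨Q, hQ⟩ := exists_polynomial_of_flat ((fourierPullback T).toLinearMap - S) (L + 1)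
    fun χ hχ => by
      have hχ0 : χ 0 = 0 := by
        have := hχ 0 (Nat.succ_pos L)
        rwa [← norm_eq_zero, norm_iteratedFDeriv_zero, norm_eq_zero] at this
      have h1 : ∀ j : ℤ, ∫ x, (𝓕 χ) x * (h j x - h j 0) = fourierPullback T
          (SchwartzMap.smulLeftCLM ℂ (fun ξ => annulus κ (dilation κ (2 ^ j) ξ)) χ) := fun j => by
        have h2 : ∫ x, (𝓕 χ) x * (h j x - h j 0) =
            (∫ x, h j x * (𝓕 χ) x) - h j 0 * ∫ x, (𝓕 χ) x := by
          rw [← integral_const_mul, ← integral_sub (hT j χ).1 ((𝓕 χ).integrable.const_mul _)]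
          exact integral_congr_ae (Eventually.of_forall fun x => by simp only; ring)
        rw [h2, integral_fourier, hχ0, mul_zero, sub_zero, (hT j χ).2]
        rfl
      have h3 := H.hasSum_integral hκ (𝓕 χ)
      simp only [h1] at h3
      -- The unconditional sum is evaluated along symmetric intervals, where it telescopes to
      -- band-pass truncations.
      have h4 : Tendsto (fun J : ℕ => Finset.Icc (-J : ℤ) J) atTop atTop := by
        refine tendsto_atTop_finset_of_monotone (fun J J' hJ => ?_) fun j => ⟨j.natAbs, ?_⟩
        · exact Finset.Icc_subset_Icc (by omega) (by omega)
        · rw [Finset.mem_Icc]; omega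
      have h5 := h3.comp h4
      have h6 : ∀ J : ℕ, ∑ j ∈ Finset.Icc (-J : ℤ) J, fourierPullback T
          (SchwartzMap.smulLeftCLM ℂ (fun ξ => annulus κ (dilation κ (2 ^ j) ξ)) χ) =
          fourierPullback T (SchwartzMap.smulLeftCLM ℂ (bandPass κ J) χ) := fun J => by
        rw [← map_sum]
        congr 1
        ext ξ
        rw [sum_apply, SchwartzMap.smulLeftCLM_apply_apply (hasTemperateGrowth_bandPass J),
          ← sum_annulus_dilation, smul_eq_mul, Finset.sum_mul]
        exact Finset.sum_congr rfl fun j _ => by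
          rw [SchwartzMap.smulLeftCLM_apply_apply (hasTemperateGrowth_annulus _), smul_eq_mul]
      simp only [Function.comp_def, h6] at h5
      have h7 := tendsto_nhds_unique h5 (hL χ fun i hi => hχ i (by omega))
      rw [LinearMap.sub_apply, sub_eq_zero]
      exact h7.symm
  refine ⟨Q, fun φ => ?_⟩
  have hφ : φ = 𝓕 (𝓕⁻ φ) := (FourierTransform.fourier_fourierInv_eq φ).symm
  have hQi : Integrable fun x => φ x * MvPolynomial.eval (fun l => (x l : ℂ)) Q := by
    refine (SchwartzMap.smulLeftCLM ℂ (fun x : EuclideanSpace ℝ (Fin n) =>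
      MvPolynomial.eval (fun l => (x l : ℂ)) Q) φ).integrable.congr
      (Eventually.of_forall fun x => ?_)
    simp only [SchwartzMap.smulLeftCLM_apply_apply (hasTemperateGrowth_eval Q), smul_eq_mul,
      mul_comm]
  simp only [mul_add]
  refine ⟨(hint φ).add hQi, ?_⟩
  rw [integral_add (hint φ) hQi]
  have := hQ (𝓕⁻ φ)
  rw [← hφ, LinearMap.sub_apply, sub_eq_iff_eq_add'] at this
  have h8 : T φ = fourierPullback T (𝓕⁻ φ) := congrArg T hφ
  have h9 : S (𝓕⁻ φ) = ∫ x, (𝓕 (𝓕⁻ φ)) x * IsDyadicFamily.sum h x := rfl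
  rw [← hφ] at h9
  rw [h8, ← h9]
  exact this

end AnisotropicSchauder

end

/-! ### The main theorem. -/

theorem theorem2p2 (n : ℕ) (κ : Fin n → ℕ) (hκ : ∀ l, 0 < κ l) (m : ℕ)
    (𝒜 ℬ : Finset (Fin n → ℕ))
    (h𝒜ℬ : ∀ α ∈ 𝒜, ∀ β ∈ ℬ, AnisotropicSchauder.weightedOrder κ (α + β) = m)
    (lam Lam : ℝ) (hlam : 0 < lam) :
    ∃ C : ℝ≥0,
      ∀ a : (Fin n → ℕ) → (Fin n → ℕ) → ℂ,
      (∀ ξ : EuclideanSpace ℝ (Fin n),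
        lam * AnisotropicSchauder.quasiNorm κ ξ ^ m ≤ ‖AnisotropicSchauder.symbol 𝒜 ℬ a ξ‖ ∧
        ‖AnisotropicSchauder.symbol 𝒜 ℬ a ξ‖ ≤ Lam * AnisotropicSchauder.quasiNorm κ ξ ^ m) →
      ∀ (u : 𝓢'(EuclideanSpace ℝ (Fin n), ℂ))
        (F : (Fin n → ℕ) → 𝓢'(EuclideanSpace ℝ (Fin n), ℂ))
        (f : (Fin n → ℕ) → EuclideanSpace ℝ (Fin n) → ℂ),
      (∀ β ∈ ℬ, Continuous (f β) ∧ AnisotropicSchauder.PolynomialGrowth (f β) ∧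
        AnisotropicSchauder.IsRepresentedBy (F β) (f β)) →
      AnisotropicSchauder.constCoeffOp 𝒜 ℬ a u
        = ∑ β ∈ ℬ, AnisotropicSchauder.multiDeriv β (F β) →
      (∫⁻ ρ in Ioo (0 : ℝ) 1,
        AnisotropicSchauder.oscillation κ ℬ f ρ / ENNReal.ofReal ρ) < ∞ →
      (∫⁻ ρ in Ioi (1 : ℝ),
        AnisotropicSchauder.oscillation κ ℬ f ρ / ENNReal.ofReal (ρ ^ 2)) < ∞ →
      ∀ α : Fin n → ℕ, (∀ β ∈ ℬ, AnisotropicSchauder.weightedOrder κ (α + β) = m) →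
        ∃ g : EuclideanSpace ℝ (Fin n) → ℂ, Continuous g ∧
          AnisotropicSchauder.IsRepresentedBy (AnisotropicSchauder.multiDeriv α u) g ∧
          ∃ Q : MvPolynomial (Fin n) ℂ, ∀ x y : EuclideanSpace ℝ (Fin n),
            ‖(g x - MvPolynomial.eval (fun l => (x l : ℂ)) Q)
                - (g y - MvPolynomial.eval (fun l => (y l : ℂ)) Q)‖ₑ
              ≤ C * AnisotropicSchauder.diniBound (AnisotropicSchauder.oscillation κ ℬ f)
                  (AnisotropicSchauder.quasiNorm κ (x - y)) := by
  open AnisotropicSchauder FourierTransform in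
  obtain ⟨B, hB⟩ := exists_kernels hκ m hlam Lam (n + 2)
  -- The 4 is the loss of the dyadic comparison; `|B|` is used since `B` carries no sign
  -- information.
  refine ⟨(pieceConst κ |B| * 4).toNNReal, fun a ha u F f hf hu hd₀ hd₁ α hα => ?_⟩
  obtain ⟨c, hc⟩ := exists_homSymbol_eq_symbol hκ h𝒜ℬ a
  have hsm : ContDiff ℝ (⊤ : ℕ∞) (symbol 𝒜 ℬ a) :=
    hc ▸ contDiff_homSymbol_uncurry.comp (contDiff_const.prodMk contDiff_id)
  choose! k hk hkB using fun (β : Fin n → ℕ) (hβ : β ∈ ℬ) =>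
    hB c (fun ξ => hc ▸ (ha ξ).2) (α + β) ((mem_weightedIndices hκ).2 (hα β hβ))
  rw [hc] at hk
  -- The mean of the kernel is its Fourier transform at the origin, where the annulus vanishes.
  have hk0 : ∀ β ∈ ℬ, ∫ y, k β y = 0 := fun β hβ => by
    rw [integral_eq_fourier_zero, hk β hβ, cutReciprocal, annulus_zero]; simp
  have hfc : ∀ β ∈ ℬ, Continuous (f β) ∧ PolynomialGrowth (f β) := fun β hβ =>
    ⟨(hf β hβ).1, (hf β hβ).2.1⟩
  have hfin : diniBound (oscillation κ ℬ f) 1 ≠ ⊤ :=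
    ENNReal.add_ne_top.2 ⟨hd₀.ne, ENNReal.mul_ne_top ENNReal.ofReal_ne_top hd₁.ne⟩
  have hosc := oscillation_zpow_ne_top oscillation_mono hfin
  have H : IsDyadicFamily κ (fun j : ℤ => piece κ ℬ k f (2 ^ j))
      (fun j : ℤ => (oscillation κ ℬ f (2 ^ j)).toReal) (pieceConst κ |B|) :=
    { const_nonneg := pieceConst_nonneg (abs_nonneg B)
      weight_nonneg := fun _ => ENNReal.toReal_nonneg
      summable := summable_dyadic oscillation_mono hfin
      norm_sub_le := fun j => norm_piece_sub_piece_le hκ hfc (by positivity) (hosc j)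
        (abs_nonneg B) (fun β hβ y => ⟨((hkB β hβ y).1).trans (le_abs_self B),
          ((hkB β hβ y).2).trans (le_abs_self B)⟩) hk0 }
  obtain ⟨Q, hQ⟩ := exists_polynomial_of_isDyadicFamily hκ H (multiDeriv α u) fun j χ => by
    have hp := fun β (hβ : β ∈ ℬ) =>
      integral_piece_mul_fourier (κ := κ) (k β) χ (hf β hβ).1 (hf β hβ).2.1 (2 ^ j)
    simp only [piece, Finset.sum_mul]
    refine ⟨integrable_finsetSum _ fun β hβ => (hp β hβ).1, ?_⟩
    rw [integral_finsetSum _ fun β hβ => (hp β hβ).1,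
      ← sum_apply_dilatedMultiplier hκ hlam hsm (fun ξ => (ha ξ).1)
        (fun t ξ => by rw [← hc]; exact homSymbol_dilation hκ c t ξ) hu hα hk]
    exact Finset.sum_congr rfl fun β hβ =>
      (hp β hβ).2.trans (((hf β hβ).2.2 _).2).symm
  refine ⟨_, ?_, hQ, Q, fun x y => ?_⟩
  · exact (H.continuous_sum hκ).add (hasTemperateGrowth_eval Q).1.continuous
  · simp only [add_sub_cancel_right]
    exact enorm_sum_sub_sum_le hκ oscillation_mono hosc H x y
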